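/- Let $n\ge 0$ be an integer, $m=\lfloor n/2\rfloor$, and let $W$ be the complex vector space with basis $f_1,\dots,f_m$. Give $\bigwedge^\bullet W$ the basis $f_\alpha=f_{\alpha_1}\wedge\cdots\wedge f_{\alpha_h}$, $\alpha=\{\alpha_1<\cdots<\alpha_h\}\subset\{1,\dots,m\}$. Let $\varepsilon_l f_\alpha=f_l\wedge f_\alpha$, and let $\iota_l f_\alpha=(-1)^{t+1}f_{\alpha\setminus\{l\}}$ if $l=\alpha_t$, $\iota_l f_\alpha=0$ if $l\notin\alpha$. The Dirac matrices are $\gamma_{2l-1}=\varepsilon_l-\iota_l$, $\gamma_{2l}=-\mathbf i(\varepsilon_l+\iota_l)$ for $1\le l\le m$ and, if $n=2m+1$, $\gamma_{n}f_\alpha=-\mathbf i(-1)^{\#\alpha}f_\alpha$; they satisfy $\gamma_j\gamma_k+\gamma_k\gamma_j=-2\delta_{jk}$. Put $\mathbb S^+=\bigwedge^{\rm even}W$, $\mathbb S^-=\bigwedge^{\rm odd}W$ if $n$ is even and $\mathbb S^+=\mathbb S^-=\bigwedge^\bullet W$ if $n$ is odd, so that $\gamma_j:\mathbb S^\pm\to\mathbb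 S^\mp$. Let $\mathscr V_0=\mathbb S^+$ and $\mathscr V_1=\mathbb C^2\otimes\mathbb S^-=\{(g_0,g_1): g_0,g_1\in\mathbb S^-\}$. On $\mathbb R^{2n}$ with coordinates $x_{Aj}$ ($A=0,1$, $1\le j\le n$) let $$(\mathscr D_0 f)_A=\sum_{j=1}^n\gamma_j\,\frac{\partial f}{\partial x_{Aj}},\qquad A=0,1,$$ for $\mathscr V_0$-valued functions, or distributions, $f$. For a finite-dimensional complex vector space $V$ let $\mathcal E(\mathbb R^{2n},V)$ be the space of smooth $V$-valued functions with the topology of uniform convergence on compact sets of the functions and all their derivatives, $\mathcal E'(\mathbb R^{2n},V)$ its dual with the strong topology (the compactly supported distributions with values in $V$, where the spinor modules are identified with their duals through the bases $f_\alpha$), and $\mathcal D(\mathbb R^{2n},V)$ the space of compactly supported smooth functions with the usual strict inductive limit topology. Then the ranges of $$\mathscr D_0:\mathcal E'(\mathbb R^{2n},\mathscr V_0)\to\mathcal E'(\mathbb R^{2n},\mathscr V_1)\qquad\text{and}\qquad \mathscr D_0:\mathcal D(\mathbb R^{2n},\mathscr V_0)\to\mathcal D(\mathbb R^{2n},\mathscr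 V_1)$$ are closed. -/

import Mathlib

open scoped Distributions ContDiff

noncomputable section

namespace DiracComplex

/-! ### Spinors

`W` has the basis `f_0, …, f_{m-1}`, `m = ⌊n/2⌋`, and `⋀W` has the orthonormal basis `f_α` indexed by
the subsets `α` of `{0, …, m-1}`. An endomorphism of `⋀W` is described by its matrix in this basis:
the entry `(β, α)` is the coefficient of `f_β` in the image of `f_α`. -/

/-- The sign `(-1)^{#{i ∈ α : i < l}}`. -/
def koszulSign {m : ℕ} (l : Fin m) (α : Finset (Fin m)) : ℂ :=
  (-1) ^ (α.filter (· < l)).card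

/-- The matrix of `γ(f_l)`, that is of `f_α ↦ f_l ∧ f_α`. -/
def wedgeMatrix {m : ℕ} (l : Fin m) : Matrix (Finset (Fin m)) (Finset (Fin m)) ℂ :=
  fun β α => if l ∉ α ∧ β = insert l α then koszulSign l α else 0

/-- The matrix of `γ(f̄_l)`, the contraction that sends `f_α` to `0` if `l ∉ α`, and to
`(-1)^{t+1} f_{α \ {l}}` if `l` is the `t`-th element of `α`. -/
def contractMatrix {m : ℕ} (l : Fin m) : Matrix (Finset (Fin m)) (Finset (Fin m)) ℂ :=
  fun β α => if l ∈ α ∧ β = α.erase l then koszulSign l α else 0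

/-- The matrix of `f_α ↦ (-1)^{#α} f_α`; for odd `n` this is `γ(f_{m+1})`. -/
def parityMatrix (m : ℕ) : Matrix (Finset (Fin m)) (Finset (Fin m)) ℂ :=
  Matrix.diagonal fun α => (-1) ^ α.card

/-- The Dirac matrices on `⋀W`. The index `j : Fin n` starts at `0`, so that `j = 2l` and
`j = 2l + 1` (with `l < m`) stand for the vectors `e = f_l - f̄_l` and `e = -i (f_l + f̄_l)`, and,
for odd `n`, the last index stands for `e_n = -i f_{m+1}`. -/
def gammaMatrix (n : ℕ) (j : Fin n) :
    Matrix (Finset (Fin (n / 2))) (Finset (Fin (n / 2))) ℂ :=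
  if h : j.val / 2 < n / 2 then
    if j.val % 2 = 0 then wedgeMatrix ⟨j.val / 2, h⟩ - contractMatrix ⟨j.val / 2, h⟩
    else (-Complex.I) • (wedgeMatrix ⟨j.val / 2, h⟩ + contractMatrix ⟨j.val / 2, h⟩)
  else (-Complex.I) • parityMatrix (n / 2)

/-- Index set of the basis of `𝕊⁺`: the even subsets if `n` is even, all subsets if `n` is odd. -/
abbrev PlusIdx (n : ℕ) : Type := {α : Finset (Fin (n / 2)) // Odd n ∨ Even α.card}

/-- Index set of the basis of `𝕊⁻`: the odd subsets if `n` is even, all subsets if `n` is odd. -/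
abbrev MinusIdx (n : ℕ) : Type := {α : Finset (Fin (n / 2)) // Odd n ∨ Odd α.card}

/-- The spinor module `𝕊⁺`: `⋀^even W` for even `n`, and `⋀W` for odd `n`, with the Hermitian inner
product for which the `f_α` are orthonormal. -/
abbrev SpinorPlus (n : ℕ) : Type := EuclideanSpace ℂ (PlusIdx n)

/-- The spinor module `𝕊⁻`: `⋀^odd W` for even `n`, and `⋀W` for odd `n`. -/
abbrev SpinorMinus (n : ℕ) : Type := EuclideanSpace ℂ (MinusIdx n)

/-- The Dirac matrices interchange `⋀^even W` and `⋀^odd W` if `n` is even, so that restricting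
`gammaMatrix n j` to the rows in `MinusIdx n` and the columns in `PlusIdx n` gives the
restriction `𝕊⁺ → 𝕊⁻` of the operator. -/
theorem gammaMatrix_eq_zero {n : ℕ} (hn : Even n) (j : Fin n) {α β : Finset (Fin (n / 2))}
    (h : Even β.card ↔ Even α.card) : gammaMatrix n j β α = 0 := by
  have hj : j.val / 2 < n / 2 := by
    have := j.isLt
    obtain ⟨k, rfl⟩ := hn
    omega
  have hw : ∀ l : Fin (n / 2), wedgeMatrix l β α = 0 := by
    intro l
    unfold wedgeMatrix
    rw [if_neg]
    rintro ⟨h1, rfl⟩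
    rw [Finset.card_insert_of_notMem h1, Nat.even_add_one] at h
    tauto
  have hc : ∀ l : Fin (n / 2), contractMatrix l β α = 0 := by
    intro l
    unfold contractMatrix
    rw [if_neg]
    rintro ⟨h1, rfl⟩
    rw [← Finset.card_erase_add_one h1, Nat.even_add_one] at h
    tauto
  unfold gammaMatrix
  rw [dif_pos hj]
  split_ifs <;> simp [hw, hc]

/-- The matrix of `γ_j : 𝕊⁺ → 𝕊⁻`. -/
def gammaPlusMatrix (n : ℕ) (j : Fin n) : Matrix (MinusIdx n) (PlusIdx n) ℂ :=
  (gammaMatrix n j).submatrix Subtype.val Subtype.val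

/-- The Dirac matrix `γ_j : 𝕊⁺ → 𝕊⁻`. -/
def gammaPlus (n : ℕ) (j : Fin n) : SpinorPlus n →L[ℂ] SpinorMinus n :=
  (Matrix.toEuclideanLin (gammaPlusMatrix n j)).toContinuousLinearMap

/-- The transpose `γ_jᵀ : 𝕊⁻ → 𝕊⁺` with respect to the bilinear pairings
`⟨u, v⟩ = ∑_α u_α v_α`, by which `𝕊⁺` and `𝕊⁻` are identified with their duals. -/
def gammaPlusTranspose (n : ℕ) (j : Fin n) : SpinorMinus n →L[ℂ] SpinorPlus n :=
  (Matrix.toEuclideanLin (gammaPlusMatrix n j).transpose).toContinuousLinearMap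

/-- `𝒱₀ = 𝕊⁺`. -/
abbrev V0 (n : ℕ) : Type := SpinorPlus n

/-- `𝒱₁ = ℂ² ⊗ 𝕊⁻`, whose elements are the pairs `(g_0, g_1)` of elements of `𝕊⁻`. (Only the
vector space topology of this finite-dimensional space is used, so the choice of norm is
immaterial.) -/
abbrev V1 (n : ℕ) : Type := Fin 2 → SpinorMinus n

/-- `ℝ^{2n}`, with coordinates `x_{Aj}`, `A ∈ {0, 1}` and `j ∈ {0, …, n-1}`. -/
abbrev Dom (n : ℕ) : Type := EuclideanSpace ℝ (Fin 2 × Fin n)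

/-- The coordinate vector in the direction of `x_{Aj}`. -/
def coordVec (n : ℕ) (i : Fin 2 × Fin n) : Dom n := EuclideanSpace.single i 1

/-- The coefficient of `∂_{Aj}` in `𝒟₀`: the map `𝕊⁺ → ℂ² ⊗ 𝕊⁻` that puts `γ_j u` in the
component `A`. -/
def diracCoeff (n : ℕ) (i : Fin 2 × Fin n) : V0 n →L[ℂ] V1 n :=
  (ContinuousLinearMap.single ℂ (fun _ : Fin 2 => SpinorMinus n) i.1).comp (gammaPlus n i.2)

/-- The transpose of `diracCoeff`, `(v_0, v_1) ↦ γ_jᵀ v_A`. -/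
def diracCoeffTranspose (n : ℕ) (i : Fin 2 × Fin n) : V1 n →L[ℂ] V0 n :=
  (gammaPlusTranspose n i.2).comp
    (ContinuousLinearMap.proj (R := ℂ) (φ := fun _ : Fin 2 => SpinorMinus n) i.1)

/-! ### The space `ℰ` of smooth functions -/

section Smooth

variable (E F G : Type*) [NormedAddCommGroup E] [NormedSpace ℝ E]
  [NormedAddCommGroup F] [NormedSpace ℂ F] [NormedAddCommGroup G] [NormedSpace ℂ G]

/-- The smooth functions `E → F` as a subspace of the space of all functions. -/
def smoothSubmodule : Submodule ℂ (E → F) where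
  carrier := {f | ContDiff ℝ ∞ f}
  add_mem' := @fun f g (hf : ContDiff ℝ ∞ f) (hg : ContDiff ℝ ∞ g) => hf.add hg
  zero_mem' := (contDiff_zero_fun : ContDiff ℝ ∞ (fun _ : E => (0 : F)))
  smul_mem' c f (hf : ContDiff ℝ ∞ f) := hf.const_smul c

/-- The space `ℰ(E, F)` of smooth functions `E → F`. -/
def SmoothFun : Type _ := smoothSubmodule E F

instance : AddCommGroup (SmoothFun E F) := inferInstanceAs (AddCommGroup (smoothSubmodule E F))

instance : Module ℂ (SmoothFun E F) := inferInstanceAs (Module ℂ (smoothSubmodule E F))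

instance : CoeFun (SmoothFun E F) (fun _ => E → F) := ⟨fun f => f.1⟩

variable {E F G}

theorem SmoothFun.contDiff (f : SmoothFun E F) : ContDiff ℝ ∞ f := f.2

theorem SmoothFun.ext {f g : SmoothFun E F} (h : ∀ x, f x = g x) : f = g :=
  Subtype.ext (funext h)

/-- The `k`-th derivative of a smooth function, as an element of the space of continuous
functions. -/
def SmoothFun.jet (k : ℕ) :
    SmoothFun E F →ₗ[ℂ] C(E, ContinuousMultilinearMap ℝ (fun _ : Fin k => E) F) where
  toFun f := ⟨iteratedFDeriv ℝ k f, f.contDiff.continuous_iteratedFDeriv (mod_cast le_top)⟩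
  map_add' f g := by
    ext1 x
    exact iteratedFDeriv_add_apply (f.contDiff.contDiffAt.of_le (mod_cast le_top))
      (g.contDiff.contDiffAt.of_le (mod_cast le_top))
  map_smul' c f := by
    ext1 x
    exact iteratedFDeriv_const_smul_apply (f.contDiff.contDiffAt.of_le (mod_cast le_top))

/-- The topology of uniform convergence on compact sets of the functions and of all their
derivatives. (The space `C(E, _)` carries the compact-open topology, which is that of uniform
convergence on compact sets.) -/
instance : TopologicalSpace (SmoothFun E F) :=
  ⨅ k : ℕ, TopologicalSpace.induced (SmoothFun.jet k) inferInstance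

instance : IsTopologicalAddGroup (SmoothFun E F) :=
  topologicalAddGroup_iInf fun k => topologicalAddGroup_induced (SmoothFun.jet k)

instance : ContinuousSMul ℂ (SmoothFun E F) :=
  continuousSMul_iInf fun k => continuousSMul_induced (SmoothFun.jet k)

theorem SmoothFun.continuous_jet (k : ℕ) :
    Continuous (SmoothFun.jet k : SmoothFun E F → _) :=
  continuous_iff_le_induced.2 (iInf_le _ k)

theorem SmoothFun.continuous_iff {X : Type*} [TopologicalSpace X] {u : X → SmoothFun E F} :
    Continuous u ↔ ∀ k, Continuous fun x => SmoothFun.jet k (u x) := by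
  simp only [continuous_iInf_rng, continuous_induced_rng]
  rfl

/-- Composition `f ↦ L ∘ f` with a linear map of the values. -/
def SmoothFun.postcomp (L : F →L[ℂ] G) : SmoothFun E F →L[ℂ] SmoothFun E G where
  toFun f := ⟨fun x => L (f x), (L.restrictScalars ℝ).contDiff.comp f.contDiff⟩
  map_add' f g := SmoothFun.ext fun x => map_add L (f x) (g x)
  map_smul' c f := SmoothFun.ext fun x => map_smul L c (f x)
  cont := by
    refine SmoothFun.continuous_iff.2 fun k => ?_
    have h : ∀ f : SmoothFun E F, SmoothFun.jet k
        (⟨fun x => L (f x), (L.restrictScalars ℝ).contDiff.comp f.contDiff⟩ : SmoothFun E G) =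
        (⟨_, (ContinuousLinearMap.compContinuousMultilinearMapL ℝ (fun _ : Fin k => E) F G
          (L.restrictScalars ℝ)).continuous⟩ : C(_, _)).comp (SmoothFun.jet k f) := by
      intro f
      ext1 x
      exact (L.restrictScalars ℝ).iteratedFDeriv_comp_left
        (f.contDiff.contDiffAt (x := x)) (i := k) (mod_cast le_top)
    exact (((ContinuousMap.continuous_postcomp _).comp (SmoothFun.continuous_jet k)).congr
      fun f => (h f).symm)

/-- The derivative `f ↦ ∂_v f` in the direction of `v`. -/
def SmoothFun.lineDeriv (v : E) : SmoothFun E F →L[ℂ] SmoothFun E F where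
  toFun f := ⟨fun x => fderiv ℝ f x v,
    (f.contDiff.fderiv_right (m := ∞) (by simp)).clm_apply contDiff_const⟩
  map_add' f g := SmoothFun.ext fun x => by
    have hf := (f.contDiff.differentiable (by simp)) x
    have hg := (g.contDiff.differentiable (by simp)) x
    exact congrArg (fun T => T v) (fderiv_add hf hg)
  map_smul' c f := SmoothFun.ext fun x => by
    have hf := (f.contDiff.differentiable (by simp)) x
    exact congrArg (fun T => T v) (fderiv_const_smul hf c)
  cont := by
    refine SmoothFun.continuous_iff.2 fun k => ?_
    have h : ∀ f : SmoothFun E F, SmoothFun.jet k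
        (⟨fun x => fderiv ℝ f x v,
          (f.contDiff.fderiv_right (m := ∞) (by simp)).clm_apply contDiff_const⟩ :
            SmoothFun E F) =
        (⟨fun T => (ContinuousLinearMap.compContinuousMultilinearMapL ℝ (fun _ : Fin k => E)
            (E →L[ℝ] F) F (ContinuousLinearMap.apply ℝ F v))
            (continuousMultilinearCurryRightEquiv' ℝ k E F T),
          (ContinuousLinearMap.continuous _).comp
            (continuousMultilinearCurryRightEquiv' ℝ k E F).continuous⟩ : C(_, _)).comp
          (SmoothFun.jet (k + 1) f) := by
      intro f
      ext1 x
      have h1 := (ContinuousLinearMap.apply ℝ F v).iteratedFDeriv_comp_left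
        ((f.contDiff.fderiv_right (m := ∞) (by simp)).contDiffAt (x := x)) (i := k)
        (mod_cast le_top)
      refine h1.trans ?_
      change _ = (ContinuousLinearMap.apply ℝ F v).compContinuousMultilinearMap
        (continuousMultilinearCurryRightEquiv' ℝ k E F (iteratedFDeriv ℝ (k + 1) f x))
      rw [iteratedFDeriv_succ_eq_comp_right, Function.comp_apply,
        LinearIsometryEquiv.apply_symm_apply]
    exact (((ContinuousMap.continuous_postcomp _).comp (SmoothFun.continuous_jet (k + 1))).congr
      fun f => (h f).symm)

end Smooth

/-- `ℰ(ℝ^{2n}, V)`. -/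
abbrev SmoothSpace (n : ℕ) (V : Type) [NormedAddCommGroup V] [NormedSpace ℂ V] : Type :=
  SmoothFun (Dom n) V

/-- `ℰ'(ℝ^{2n}, V)`, the dual of `ℰ(ℝ^{2n}, V)` with the strong topology, that is the topology of
uniform convergence on bounded sets (Mathlib's topology on spaces of continuous linear maps). -/
abbrev CompactDistr (n : ℕ) (V : Type) [NormedAddCommGroup V] [NormedSpace ℂ V] : Type :=
  SmoothSpace n V →L[ℂ] ℂ

/-- `𝒟(ℝ^{2n}, V)`, the smooth compactly supported functions with the inductive limit topology
(Mathlib's space of test functions). -/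
abbrev TestSpace (n : ℕ) (V : Type) [NormedAddCommGroup V] [NormedSpace ℂ V] : Type :=
  𝓓((⊤ : TopologicalSpace.Opens (Dom n)), V)

/-! ### The operator `𝒟₀` -/

/-- `𝒟₀ : 𝒟(ℝ^{2n}, 𝒱₀) → 𝒟(ℝ^{2n}, 𝒱₁)`, `(𝒟₀ f)_A = ∑_j γ_j ∂_{Aj} f`. -/
def diracTest (n : ℕ) : TestSpace n (V0 n) →L[ℂ] TestSpace n (V1 n) :=
  ∑ i : Fin 2 × Fin n, (TestFunction.postcompCLM (diracCoeff n i)).comp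
    (TestFunction.lineDerivCLM ℂ (coordVec n i))

/-- The formal transpose of `𝒟₀` on smooth functions,
`𝒟₀ᵗ : ℰ(ℝ^{2n}, 𝒱₁) → ℰ(ℝ^{2n}, 𝒱₀)`, `𝒟₀ᵗ φ = - ∑_{A,j} γ_jᵀ ∂_{Aj} φ_A`. -/
def diracTranspose (n : ℕ) : SmoothSpace n (V1 n) →L[ℂ] SmoothSpace n (V0 n) :=
  -∑ i : Fin 2 × Fin n, (SmoothFun.postcomp (diracCoeffTranspose n i)).comp
    (SmoothFun.lineDeriv (coordVec n i))

/-- `𝒟₀ : ℰ'(ℝ^{2n}, 𝒱₀) → ℰ'(ℝ^{2n}, 𝒱₁)`, the operator `𝒟₀` in the sense of distributions: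
`⟨𝒟₀ T, φ⟩ = ⟨T, 𝒟₀ᵗ φ⟩`. -/
def diracDistr (n : ℕ) : CompactDistr n (V0 n) →L[ℂ] CompactDistr n (V1 n) :=
  ContinuousLinearMap.precomp ℂ (diracTranspose n)

theorem diracTest_apply (n : ℕ) (f : TestSpace n (V0 n)) (x : Dom n) (A : Fin 2) :
    diracTest n f x A = ∑ j : Fin n, gammaPlus n j (fderiv ℝ f x (coordVec n (A, j))) := by
  have hterm : ∀ i : Fin 2 × Fin n,
      (TestFunction.postcompCLM (diracCoeff n i) (TestFunction.lineDerivCLM ℂ (coordVec n i) f) :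
        TestSpace n (V1 n)) x A =
      if i.1 = A then gammaPlus n i.2 (fderiv ℝ f x (coordVec n i)) else 0 := by
    intro i
    rw [TestFunction.postcompCLM_apply, Function.comp_apply,
      TestFunction.lineDerivCLM_eq_fderivCLM, TestFunction.fderivCLM_apply_of_le _ (by simp)]
    by_cases h : i.1 = A
    · subst h
      simp [diracCoeff]
    · simp [diracCoeff, h]
  simp only [diracTest, sum_apply, ContinuousLinearMap.comp_apply, Finset.sum_apply]
  rw [Finset.sum_congr rfl fun i _ => hterm i, Fintype.sum_prod_type]
  simp

theorem diracTranspose_apply (n : ℕ) (φ : SmoothSpace n (V1 n)) (x : Dom n) :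
    diracTranspose n φ x =
      -∑ i : Fin 2 × Fin n, gammaPlusTranspose n i.2 (fderiv ℝ φ x (coordVec n i) i.1) := by
  have hsum : ∀ (s : Finset (Fin 2 × Fin n)) (u : Fin 2 × Fin n → SmoothSpace n (V0 n)),
      (∑ i ∈ s, u i) x = ∑ i ∈ s, u i x := by
    intro s u
    induction s using Finset.cons_induction with
    | empty => rfl
    | cons a s ha ih =>
      rw [Finset.sum_cons, Finset.sum_cons, ← ih]
      rfl
  have hneg : ∀ u : SmoothSpace n (V0 n), (-u) x = -u x := fun _ => rfl
  simp only [diracTranspose, neg_apply, sum_apply,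
    ContinuousLinearMap.comp_apply]
  rw [hneg, hsum]
  rfl

theorem diracDistr_apply (n : ℕ) (T : CompactDistr n (V0 n)) (φ : SmoothSpace n (V1 n)) :
    diracDistr n T φ = T (diracTranspose n φ) := rfl

end DiracComplex

end

/-! Write 𝒟₀ = ∑ c_i ∂_i over the 2n coordinates, with c_i = `diracCoeff n i`, and let a_i =
`diracAdjCoeff n i` be the adjoint coefficients. The Clifford relations give a(ξ)c(ξ) = |ξ|², so
|ξ|⁻²a(ξ) is a left inverse of the symbol. Its pole of order one is integrable because 2n ≥ 2; for n
= 0 the operators are zero. Each range is then identified with a set cut out by closed conditions.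

Test functions: g lies in the range iff c(ξ)a(ξ)𝓕⁻g(ξ) = |ξ|²𝓕⁻g(ξ) for all ξ, a condition
continuous in g. If it holds, the multiplier yields a smooth solution f of 𝒟₀f = g that tends to
zero at infinity by the Riemann–Lebesgue lemma. Its support is compact because there are two groups
of variables: when |x_B| is large, ∑ γ_j ∂_{Aj} f = 0 on the whole n-plane of points with this x_B,
so f is harmonic there and vanishes by the maximum principle (`eq_zero_of_harmonic_of_tendsto_zero`,
`mem_range_diracTest`).

Distributions: the range is the annihilator of the kernel of 𝒟₀ᵗ. Transposition turns the left
inverse into a right inverse P of 𝒟₀ᵗ. If T kills the kernel, then S = T ∘ P is tempered and S(𝒟₀ᵗφ)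
= T(φ) (`parametrixDistr_schwartzOp`). The Laplacian in x_A factors through 𝒟₀ᵗ, so the same
Liouville argument, applied to S along translates of θ, shows that S vanishes on every θ that is
zero on a suitable slab |x_B|² < r (`parametrixDistr_eq_zero`). Cutting S off in both groups of
variables gives the preimage of T (`mem_range_diracDistr`). -/

noncomputable section

namespace DiracComplex

/-! ### Clifford relations -/

/-- The set by which the Dirac matrix `gammaMatrix n j` shifts the basis vectors. -/
def gammaFlip (n : ℕ) (j : Fin n) : Finset (Fin (n / 2)) :=
  if h : j.val / 2 < n / 2 then {⟨j.val / 2, h⟩} else ∅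

/-- The coefficient of `gammaMatrix n j` on the basis vector `f_α`. -/
def gammaCoeff (n : ℕ) (j : Fin n) (α : Finset (Fin (n / 2))) : ℂ :=
  if h : j.val / 2 < n / 2 then
    koszulSign ⟨j.val / 2, h⟩ α *
      if j.val % 2 = 0 then (if (⟨j.val / 2, h⟩ : Fin (n / 2)) ∈ α then -1 else 1) else -Complex.I
  else -Complex.I * (-1) ^ α.card

theorem symmDiff_singleton_of_mem {ι : Type*} [DecidableEq ι] {l : ι} {α : Finset ι} (h : l ∈ α) :
    symmDiff α {l} = α.erase l := by
  ext x
  by_cases hx : x = l <;> simp [Finset.mem_symmDiff, hx, h]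

theorem symmDiff_singleton_of_notMem {ι : Type*} [DecidableEq ι] {l : ι} {α : Finset ι}
    (h : l ∉ α) : symmDiff α {l} = insert l α := by
  ext x
  by_cases hx : x = l <;> simp [Finset.mem_symmDiff, hx, h]

/-- Exterior multiplication and contraction by f_l both toggle l in α, with the same Koszul sign. So
each Dirac matrix is monomial, and the Clifford relations reduce to identities between coefficients.
-/
theorem gammaMatrix_apply (n : ℕ) (j : Fin n) (β α : Finset (Fin (n / 2))) :
    gammaMatrix n j β α = if β = symmDiff α (gammaFlip n j) then gammaCoeff n j α else 0 := by
  unfold gammaMatrix gammaFlip gammaCoeff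
  by_cases h : j.val / 2 < n / 2
  · simp only [dif_pos h]
    by_cases hl : (⟨j.val / 2, h⟩ : Fin (n / 2)) ∈ α
    · rw [symmDiff_singleton_of_mem hl]
      by_cases hj : j.val % 2 = 0 <;> by_cases hβ : β = α.erase ⟨j.val / 2, h⟩ <;>
        simp [hj, hl, hβ, wedgeMatrix, contractMatrix, mul_comm]
    · rw [symmDiff_singleton_of_notMem hl]
      by_cases hj : j.val % 2 = 0 <;> by_cases hβ : β = insert ⟨j.val / 2, h⟩ α <;>
        simp [hj, hl, hβ, wedgeMatrix, contractMatrix, mul_comm]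
  · simp only [dif_neg h, parityMatrix, Matrix.smul_apply, Matrix.diagonal_apply]
    rw [← Finset.bot_eq_empty, symmDiff_bot]
    by_cases hβ : β = α <;> simp [hβ]

theorem koszulSign_mul_self {m : ℕ} (l : Fin m) (α : Finset (Fin m)) :
    koszulSign l α * koszulSign l α = 1 := by
  unfold koszulSign
  rw [← mul_pow]
  simp

theorem koszulSign_symmDiff {m : ℕ} (l k : Fin m) (α : Finset (Fin m)) :
    koszulSign l (symmDiff α {k}) = if k < l then -koszulSign l α else koszulSign l α := by
  unfold koszulSign
  by_cases hk : k ∈ α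
  · rw [symmDiff_singleton_of_mem hk, Finset.filter_erase]
    split_ifs with h
    · have hm : k ∈ α.filter (· < l) := by simp [hk, h]
      rw [← Finset.card_erase_add_one hm, pow_succ]
      simp
    · rw [Finset.erase_eq_of_notMem (by simp [h])]
  · rw [symmDiff_singleton_of_notMem hk, Finset.filter_insert]
    split_ifs with h
    · rw [Finset.card_insert_of_notMem (by simp [hk]), pow_succ]
      simp
    · rfl

theorem neg_one_pow_card_symmDiff {m : ℕ} (k : Fin m) (α : Finset (Fin m)) :
    (-1 : ℂ) ^ (symmDiff α {k}).card = -(-1) ^ α.card := by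
  by_cases hk : k ∈ α
  · rw [symmDiff_singleton_of_mem hk, ← Finset.card_erase_add_one hk, pow_succ]
    simp
  · rw [symmDiff_singleton_of_notMem hk, Finset.card_insert_of_notMem hk, pow_succ]
    simp

theorem mem_symmDiff_singleton_self {ι : Type*} [DecidableEq ι] (l : ι) (α : Finset ι) :
    l ∈ symmDiff α {l} ↔ l ∉ α := by
  simp [Finset.mem_symmDiff]

theorem mem_symmDiff_singleton_of_ne {ι : Type*} [DecidableEq ι] {l k : ι} (h : l ≠ k)
    (α : Finset ι) : l ∈ symmDiff α {k} ↔ l ∈ α := by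
  simp [Finset.mem_symmDiff, h]

/-- One sign changes in exactly one of the two orders. For distinct f_l, toggling the smaller index
flips the Koszul sign of the larger one and not conversely; for the two matrices of the same f_l,
toggling l flips the sign of ε_l - ι_l; for the last matrix of odd n, toggling flips the parity of
α. -/
theorem gammaCoeff_anticomm {n : ℕ} {j k : Fin n} (hjk : j ≠ k) (α : Finset (Fin (n / 2))) :
    gammaCoeff n j (symmDiff α (gammaFlip n k)) * gammaCoeff n k α +
      gammaCoeff n k (symmDiff α (gammaFlip n j)) * gammaCoeff n j α = 0 := by
  have hne : j.val ≠ k.val := fun h => hjk (Fin.ext h)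
  unfold gammaFlip gammaCoeff
  by_cases hj : j.val / 2 < n / 2 <;> by_cases hk : k.val / 2 < n / 2
  · simp only [dif_pos hj, dif_pos hk, koszulSign_symmDiff, Fin.mk_lt_mk]
    rcases lt_trichotomy (j.val / 2) (k.val / 2) with h | h | h
    · have h1 : (⟨j.val / 2, hj⟩ : Fin (n / 2)) ≠ ⟨k.val / 2, hk⟩ := by simpa using h.ne
      simp only [if_neg h.not_gt, if_pos h, mem_symmDiff_singleton_of_ne h1,
        mem_symmDiff_singleton_of_ne h1.symm]
      ring
    · simp only [← h, lt_irrefl, if_false, mem_symmDiff_singleton_self]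
      by_cases h1 : j.val % 2 = 0
      · have h2 : ¬ k.val % 2 = 0 := by omega
        by_cases hm : (⟨j.val / 2, hj⟩ : Fin (n / 2)) ∈ α <;> simp [h1, h2, hm] <;> ring
      · have h2 : k.val % 2 = 0 := by omega
        by_cases hm : (⟨j.val / 2, hj⟩ : Fin (n / 2)) ∈ α <;> simp [h1, h2, hm] <;> ring
    · have h1 : (⟨j.val / 2, hj⟩ : Fin (n / 2)) ≠ ⟨k.val / 2, hk⟩ := by simpa using h.ne'
      simp only [if_neg h.not_gt, if_pos h, mem_symmDiff_singleton_of_ne h1,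
        mem_symmDiff_singleton_of_ne h1.symm]
      ring
  · simp only [dif_pos hj, dif_neg hk, neg_one_pow_card_symmDiff]
    simp only [← Finset.bot_eq_empty, symmDiff_bot]
    ring
  · simp only [dif_pos hk, dif_neg hj, neg_one_pow_card_symmDiff]
    simp only [← Finset.bot_eq_empty, symmDiff_bot]
    ring
  · have := j.isLt
    have := k.isLt
    omega

theorem gammaCoeff_sq {n : ℕ} (j : Fin n) (α : Finset (Fin (n / 2))) :
    gammaCoeff n j (symmDiff α (gammaFlip n j)) * gammaCoeff n j α = -1 := by
  unfold gammaFlip gammaCoeff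
  by_cases hj : j.val / 2 < n / 2
  · simp only [dif_pos hj, koszulSign_symmDiff, lt_irrefl, if_false, mem_symmDiff_singleton_self]
    rw [mul_mul_mul_comm, koszulSign_mul_self]
    by_cases h1 : j.val % 2 = 0
    · by_cases hm : (⟨j.val / 2, hj⟩ : Fin (n / 2)) ∈ α <;> simp [h1, hm]
    · simp [h1]
  · simp only [dif_neg hj]
    simp only [← Finset.bot_eq_empty, symmDiff_bot]
    rw [mul_mul_mul_comm, ← mul_pow]
    simp

theorem gammaMatrix_mul_apply (n : ℕ) (j k : Fin n) (β α : Finset (Fin (n / 2))) :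
    (gammaMatrix n j * gammaMatrix n k) β α =
      if β = symmDiff α (symmDiff (gammaFlip n j) (gammaFlip n k)) then
        gammaCoeff n j (symmDiff α (gammaFlip n k)) * gammaCoeff n k α else 0 := by
  rw [Matrix.mul_apply, Finset.sum_eq_single (symmDiff α (gammaFlip n k))]
  · rw [gammaMatrix_apply, gammaMatrix_apply, if_pos rfl, symmDiff_assoc,
      symmDiff_comm (gammaFlip n k)]
    simp
  · intro δ _ hδ
    rw [gammaMatrix_apply n k, if_neg hδ, mul_zero]
  · simp

/-- The Clifford relations. -/
theorem gammaMatrix_clifford (n : ℕ) (j k : Fin n) :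
    gammaMatrix n j * gammaMatrix n k + gammaMatrix n k * gammaMatrix n j =
      if j = k then (-2 : ℂ) • 1 else 0 := by
  ext β α
  rw [Matrix.add_apply, gammaMatrix_mul_apply, gammaMatrix_mul_apply,
    symmDiff_comm (gammaFlip n k)]
  split_ifs with hβ hjk hjk
  · subst hjk
    rw [gammaCoeff_sq]
    rw [symmDiff_self, symmDiff_bot] at hβ
    rw [hβ]
    norm_num
  · rw [gammaCoeff_anticomm hjk]
    rfl
  · subst hjk
    rw [symmDiff_self, symmDiff_bot] at hβ
    simp [hβ]
  · simp

/-- The matrix of `-γ_j : 𝕊⁻ → 𝕊⁺`, the adjoint of `γ_j : 𝕊⁺ → 𝕊⁻`. -/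
def gammaAdjMatrix (n : ℕ) (j : Fin n) : Matrix (PlusIdx n) (MinusIdx n) ℂ :=
  (-gammaMatrix n j).submatrix Subtype.val Subtype.val

/-- The product on the left sums over `MinusIdx n` only. For even n the missing intermediate indices
contribute nothing, because γ_k changes parity. -/
theorem gammaAdjMatrix_mul_gammaPlusMatrix (n : ℕ) (j k : Fin n) :
    gammaAdjMatrix n j * gammaPlusMatrix n k =
      (-(gammaMatrix n j * gammaMatrix n k)).submatrix Subtype.val Subtype.val := by
  ext β α
  simp only [gammaAdjMatrix, gammaPlusMatrix, Matrix.mul_apply, Matrix.submatrix_apply,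
    Matrix.neg_apply, neg_mul, Finset.sum_neg_distrib, neg_inj]
  rw [← Finset.sum_subtype (Finset.univ.filter
      fun δ : Finset (Fin (n / 2)) => Odd n ∨ Odd δ.card) (by simp)
      fun δ => gammaMatrix n j β.1 δ * gammaMatrix n k δ α.1]
  refine Finset.sum_filter_of_ne fun δ _ hδ => ?_
  by_contra hc
  rw [not_or, Nat.not_odd_iff_even, Nat.not_odd_iff_even] at hc
  have hα : Even α.1.card := α.2.resolve_left (Nat.not_odd_iff_even.2 hc.1)
  exact hδ (by rw [gammaMatrix_eq_zero hc.1 k (iff_of_true hc.2 hα), mul_zero])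

theorem gammaAdjMatrix_clifford (n : ℕ) (j k : Fin n) :
    gammaAdjMatrix n j * gammaPlusMatrix n k + gammaAdjMatrix n k * gammaPlusMatrix n j =
      if j = k then (2 : ℂ) • 1 else 0 := by
  rw [gammaAdjMatrix_mul_gammaPlusMatrix, gammaAdjMatrix_mul_gammaPlusMatrix]
  have h := gammaMatrix_clifford n j k
  ext β α
  have h' := congrFun (congrFun h β.1) α.1
  simp only [Matrix.add_apply, Matrix.submatrix_apply, Matrix.neg_apply] at h' ⊢
  rw [← neg_add, h']
  split_ifs
  · by_cases hβ : β = α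
    · simp [hβ]
    · simp [hβ, Subtype.ext_iff.not.1 hβ]
  · simp

/-- The adjoint `𝕊⁻ → 𝕊⁺` of `γ_j`. -/
def gammaAdj (n : ℕ) (j : Fin n) : SpinorMinus n →L[ℂ] SpinorPlus n :=
  (Matrix.toEuclideanLin (gammaAdjMatrix n j)).toContinuousLinearMap

/-- The transpose of `gammaAdj n j`. -/
def gammaAdjTranspose (n : ℕ) (j : Fin n) : SpinorPlus n →L[ℂ] SpinorMinus n :=
  (Matrix.toEuclideanLin (gammaAdjMatrix n j).transpose).toContinuousLinearMap

theorem gammaAdj_clifford (n : ℕ) (j k : Fin n) (u : SpinorPlus n) :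
    gammaAdj n j (gammaPlus n k u) + gammaAdj n k (gammaPlus n j u) =
      if j = k then (2 : ℂ) • u else 0 := by
  have h := congrArg (fun M => Matrix.toEuclideanLin M u) (gammaAdjMatrix_clifford n j k)
  simp only [map_add, LinearMap.add_apply] at h
  have hmul : ∀ i l : Fin n, Matrix.toEuclideanLin (gammaAdjMatrix n i * gammaPlusMatrix n l) u =
      gammaAdj n i (gammaPlus n l u) := by
    intro i l
    apply (WithLp.equiv 2 _).injective
    simp [gammaAdj, gammaPlus, Matrix.toEuclideanLin, Matrix.mulVec_mulVec]
  rw [hmul, hmul] at h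
  rw [h]
  split_ifs
  · apply (WithLp.equiv 2 _).injective
    simp [Matrix.toEuclideanLin]
  · simp

/-- Transposition reverses products: the left inverse of the symbol of 𝒟₀ becomes a right inverse of
the symbol of 𝒟₀ᵗ. -/
theorem gammaPlusTranspose_clifford (n : ℕ) (j k : Fin n) (u : SpinorPlus n) :
    gammaPlusTranspose n j (gammaAdjTranspose n k u) +
      gammaPlusTranspose n k (gammaAdjTranspose n j u) = if j = k then (2 : ℂ) • u else 0 := by
  have h := congrArg (fun M => Matrix.toEuclideanLin M.transpose u) (gammaAdjMatrix_clifford n k j)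
  simp only [Matrix.transpose_add, Matrix.transpose_mul, map_add, LinearMap.add_apply] at h
  have hmul : ∀ i l : Fin n,
      Matrix.toEuclideanLin ((gammaPlusMatrix n i).transpose * (gammaAdjMatrix n l).transpose) u =
      gammaPlusTranspose n i (gammaAdjTranspose n l u) := by
    intro i l
    apply (WithLp.equiv 2 _).injective
    simp [gammaPlusTranspose, gammaAdjTranspose, Matrix.toEuclideanLin, Matrix.mulVec_mulVec]
  rw [hmul, hmul] at h
  rw [h]
  simp only [eq_comm (a := j)]
  split_ifs
  · apply (WithLp.equiv 2 _).injective
    simp [Matrix.toEuclideanLin]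
  · simp

end DiracComplex

namespace DiracComplex

/-! ### Algebra of symbols -/

/-- A symmetric family b sees only the symmetrization of C, which is diagonal. It is used with b i k
= ξ_i ξ_k u for symbols and with second derivatives for operators. -/
theorem sum_clifford {ι V : Type*} [Fintype ι] [DecidableEq ι] [AddCommGroup V] [Module ℂ V]
    {C : ι → ι → V → V}
    (hC : ∀ i k u, C i k u + C k i u = if i = k then (2 : ℂ) • u else 0)
    {b : ι → ι → V} (hb : ∀ i k, b i k = b k i) :
    ∑ i, ∑ k, C i k (b i k) = ∑ i, b i i := by
  have h : (2 : ℂ) • ∑ i, ∑ k, C i k (b i k) = (2 : ℂ) • ∑ i, b i i := by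
    rw [two_smul]
    nth_rewrite 2 [Finset.sum_comm]
    simp only [← Finset.sum_add_distrib, Finset.smul_sum]
    refine Finset.sum_congr rfl fun i _ => ?_
    calc ∑ k, (C i k (b i k) + C k i (b k i)) = ∑ k, if i = k then (2 : ℂ) • b i k else 0 :=
          Finset.sum_congr rfl fun k _ => by rw [hb k i, hC]
      _ = _ := by simp
  exact smul_right_injective V (two_ne_zero (α := ℂ)) h

/-- The adjoint of `diracCoeff n i`. -/
def diracAdjCoeff (n : ℕ) (i : Fin 2 × Fin n) : V1 n →L[ℂ] V0 n :=
  (gammaAdj n i.2).comp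
    (ContinuousLinearMap.proj (R := ℂ) (φ := fun _ : Fin 2 => SpinorMinus n) i.1)

/-- The transpose of `diracAdjCoeff n i`. -/
def diracAdjCoeffTranspose (n : ℕ) (i : Fin 2 × Fin n) : V0 n →L[ℂ] V1 n :=
  (ContinuousLinearMap.single ℂ (fun _ : Fin 2 => SpinorMinus n) i.1).comp
    (gammaAdjTranspose n i.2)

theorem diracAdjCoeff_clifford (n : ℕ) (i k : Fin 2 × Fin n) (u : V0 n) :
    diracAdjCoeff n i (diracCoeff n k u) + diracAdjCoeff n k (diracCoeff n i u) =
      if i = k then (2 : ℂ) • u else 0 := by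
  have h : ∀ i k : Fin 2 × Fin n, diracAdjCoeff n i (diracCoeff n k u) =
      if i.1 = k.1 then gammaAdj n i.2 (gammaPlus n k.2 u) else 0 := by
    intro i k
    by_cases h : i.1 = k.1
    · simp [diracAdjCoeff, diracCoeff, h]
    · simp [diracAdjCoeff, diracCoeff, h]
  rw [h, h]
  by_cases h1 : i.1 = k.1
  · rw [if_pos h1, if_pos h1.symm, gammaAdj_clifford]
    simp [Prod.ext_iff, h1]
  · rw [if_neg h1, if_neg (Ne.symm h1)]
    simp [Prod.ext_iff, h1]

theorem diracCoeffTranspose_clifford (n : ℕ) (i k : Fin 2 × Fin n) (u : V0 n) :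
    diracCoeffTranspose n i (diracAdjCoeffTranspose n k u) +
      diracCoeffTranspose n k (diracAdjCoeffTranspose n i u) =
      if i = k then (2 : ℂ) • u else 0 := by
  have h : ∀ i k : Fin 2 × Fin n, diracCoeffTranspose n i (diracAdjCoeffTranspose n k u) =
      if i.1 = k.1 then gammaPlusTranspose n i.2 (gammaAdjTranspose n k.2 u) else 0 := by
    intro i k
    by_cases h : i.1 = k.1
    · simp [diracCoeffTranspose, diracAdjCoeffTranspose, h]
    · simp [diracCoeffTranspose, diracAdjCoeffTranspose, h]
  rw [h, h]
  by_cases h1 : i.1 = k.1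
  · rw [if_pos h1, if_pos h1.symm, gammaPlusTranspose_clifford]
    simp [Prod.ext_iff, h1]
  · rw [if_neg h1, if_neg (Ne.symm h1)]
    simp [Prod.ext_iff, h1]

/-! ### A Liouville theorem -/

open Filter Topology

/-- If c were positive, the point would also be a local minimum, so φ would be locally constant and
c would be zero. -/
theorem second_deriv_nonpos_of_isLocalMax {φ φ' : ℝ → ℝ} {c x : ℝ} (h : IsLocalMax φ x)
    (h1 : ∀ t, HasDerivAt φ (φ' t) t) (h2 : HasDerivAt φ' c x) : c ≤ 0 := by
  by_contra! hc
  have hd : deriv φ = φ' := funext fun t => (h1 t).deriv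
  have hmin : IsLocalMin φ x := by
    refine isLocalMin_of_deriv_deriv_pos ?_ h.deriv_eq_zero (h1 x).continuousAt
    rwa [hd, h2.deriv]
  have he : φ =ᶠ[𝓝 x] fun _ => φ x := by
    filter_upwards [h, hmin] with y hy1 hy2 using le_antisymm hy1 hy2
  have he' : φ' =ᶠ[𝓝 x] fun _ => 0 := by
    rw [← hd]
    exact he.deriv.trans (by simp)
  have := (he'.deriv_eq.symm.trans h2.deriv)
  simp at this
  exact hc.ne this

variable {E : Type*} [NormedAddCommGroup E] [InnerProductSpace ℝ E] [FiniteDimensional ℝ E]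
  {ι : Type*} [Fintype ι] [Nonempty ι]

/-- A function that vanishes at infinity and is harmonic in the directions of some vectors along a
closed set invariant under translation by these vectors is nonpositive on this set. -/
theorem nonpos_of_harmonic_of_tendsto_zero {e : ι → E} (he : ∀ i, e i ≠ 0) {A : Set E}
    (hA : IsClosed A) (hAe : ∀ x ∈ A, ∀ i, ∀ t : ℝ, x + t • e i ∈ A) {f : E → ℝ}
    (hf : ContDiff ℝ 2 f) (h0 : Tendsto f (cocompact E) (𝓝 0))
    (hΔ : ∀ x ∈ A, ∑ i, fderiv ℝ (fun z => fderiv ℝ f z (e i)) x (e i) = 0) :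
    ∀ x ∈ A, f x ≤ 0 := by
  intro x hx
  by_contra! hpos
  obtain ⟨R, hR⟩ : ∃ R, ∀ y, R < ‖y‖ → f y < f x / 2 := by
    have h := h0.eventually (gt_mem_nhds (half_pos hpos))
    rw [← Metric.cobounded_eq_cocompact] at h
    obtain ⟨R, -, hR⟩ := (hasBasis_cobounded_norm (E := E)).eventually_iff.1 h
    exact ⟨R, fun y hy => hR (show R ≤ ‖y‖ from hy.le)⟩
  set ρ := max R ‖x‖ + 1 with hρ
  have hρpos : 0 < ρ := by positivity
  -- Adding ε‖y‖² makes the Laplacian strictly positive but changes f by at most f x / 4 on the ball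
  -- of radius ρ. As f < f x / 2 on its boundary, the maximum of h over A within the ball is
  -- attained at an interior point of the ball.
  set ε := f x / (4 * ρ ^ 2) with hε
  have hεpos : 0 < ε := by positivity
  set h : E → ℝ := fun y => f y + ε * ‖y‖ ^ 2 with hh
  have hhc : Continuous h := hf.continuous.add (continuous_const.mul (continuous_norm.pow 2))
  have hxρ : ‖x‖ < ρ := by
    have := le_max_right R ‖x‖
    linarith
  obtain ⟨p, ⟨hpA, hpρ⟩, hpmax⟩ : ∃ p ∈ A ∩ Metric.closedBall 0 ρ,
      IsMaxOn h (A ∩ Metric.closedBall 0 ρ) p :=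
    ((isCompact_closedBall (0 : E) ρ).inter_left hA).exists_isMaxOn
      ⟨x, hx, by simpa using hxρ.le⟩ hhc.continuousOn
  have hpx : f x ≤ h p := by
    have h1 : h x ≤ h p := hpmax ⟨hx, by simpa using hxρ.le⟩
    have h2 : f x ≤ h x := by
      simp only [hh]
      have : 0 ≤ ε * ‖x‖ ^ 2 := by positivity
      linarith
    exact h2.trans h1
  rw [mem_closedBall_zero_iff] at hpρ
  have hpR : ‖p‖ < ρ := by
    by_contra! hge
    have h1 : f p < f x / 2 := hR p (by
      have := le_max_left R ‖x‖
      linarith)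
    have h2 : ε * ‖p‖ ^ 2 ≤ f x / 4 := by
      have h3 : ‖p‖ ^ 2 ≤ ρ ^ 2 := by gcongr
      calc ε * ‖p‖ ^ 2 ≤ ε * ρ ^ 2 := by gcongr
        _ = f x / 4 := by
          rw [hε]
          field_simp
    simp only [hh] at hpx
    linarith
  -- The line through p in the direction e i stays in A, so h restricted to it has a local maximum
  -- at p.
  have hle : ∀ i, fderiv ℝ (fun z => fderiv ℝ f z (e i)) p (e i) + 2 * ε * ‖e i‖ ^ 2 ≤ 0 := by
    intro i
    have hline : ∀ t : ℝ, HasDerivAt (fun s : ℝ => p + s • e i) (e i) t := by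
      intro t
      simpa using ((hasDerivAt_id t).smul_const (e i)).const_add p
    refine second_deriv_nonpos_of_isLocalMax (φ := fun t => h (p + t • e i))
      (φ' := fun t => fderiv ℝ f (p + t • e i) (e i) + ε * (2 * inner ℝ (p + t • e i) (e i)))
      (x := 0) ?_ ?_ ?_
    · have hc : Tendsto (fun t : ℝ => p + t • e i) (𝓝 0) (𝓝 p) := by
        have : Continuous fun t : ℝ => p + t • e i := by fun_prop
        simpa using this.tendsto 0
      have hev : ∀ᶠ t : ℝ in 𝓝 0, p + t • e i ∈ Metric.ball (0 : E) ρ :=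
        hc.eventually (Metric.isOpen_ball.mem_nhds (by simpa using hpR))
      filter_upwards [hev] with t ht
      have := hpmax ⟨hAe p hpA i t, Metric.ball_subset_closedBall ht⟩
      simpa using this
    · intro t
      have h1 := (hf.differentiable (by simp) (p + t • e i)).hasFDerivAt.comp_hasDerivAt t (hline t)
      exact h1.add ((hline t).norm_sq.const_mul ε)
    · have hd : DifferentiableAt ℝ (fun z => fderiv ℝ f z (e i)) (p + (0 : ℝ) • e i) :=
        (((hf.fderiv_right (m := 1) (by norm_num)).clm_apply contDiff_const).differentiable
          (by simp)) _
      have h1 := hd.hasFDerivAt.comp_hasDerivAt (0 : ℝ) (hline 0)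
      have h2 := (((hline 0).inner ℝ (hasDerivAt_const (0 : ℝ) (e i))).const_mul 2).const_mul ε
      refine (h1.add h2).congr_deriv ?_
      simp only [zero_smul, add_zero, inner_zero_right, real_inner_self_eq_norm_sq, zero_add]
      ring
  have hsum := Finset.sum_le_sum fun i (_ : i ∈ Finset.univ) => hle i
  rw [Finset.sum_add_distrib, hΔ p hpA, zero_add, Finset.sum_const_zero] at hsum
  have : 0 < ∑ i, 2 * ε * ‖e i‖ ^ 2 :=
    Finset.sum_pos (fun i _ => by have := norm_pos_iff.2 (he i); positivity) Finset.univ_nonempty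
  linarith

/-- Apply the scalar bound to L ∘ f and -L ∘ f for every real continuous functional L; these
functionals separate points. -/
theorem eq_zero_of_harmonic_of_tendsto_zero {F : Type*} [NormedAddCommGroup F] [NormedSpace ℝ F]
    {e : ι → E} (he : ∀ i, e i ≠ 0) {A : Set E}
    (hA : IsClosed A) (hAe : ∀ x ∈ A, ∀ i, ∀ t : ℝ, x + t • e i ∈ A) {f : E → F}
    (hf : ContDiff ℝ 2 f) (h0 : Tendsto f (cocompact E) (𝓝 0))
    (hΔ : ∀ x ∈ A, ∑ i, fderiv ℝ (fun z => fderiv ℝ f z (e i)) x (e i) = 0) :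
    ∀ x ∈ A, f x = 0 := by
  intro x hx
  have key : ∀ L : F →L[ℝ] ℝ, L (f x) ≤ 0 := by
    intro L
    refine nonpos_of_harmonic_of_tendsto_zero he hA hAe (f := fun x => L (f x))
      (L.contDiff.comp hf) ?_ ?_ x hx
    · have := (L.continuous.tendsto 0).comp h0
      rwa [map_zero] at this
    intro y hy
    have h1 : ∀ i, (fun z => fderiv ℝ (fun x => L (f x)) z (e i)) =
        fun z => L (fderiv ℝ f z (e i)) := by
      intro i
      ext z
      have := (L.hasFDerivAt.comp z (hf.differentiable (by simp) z).hasFDerivAt).fderiv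
      exact congrArg (fun T => T (e i)) this
    have h2 : ∀ i, fderiv ℝ (fun z => fderiv ℝ (fun x => L (f x)) z (e i)) y (e i) =
        L (fderiv ℝ (fun z => fderiv ℝ f z (e i)) y (e i)) := by
      intro i
      rw [h1]
      have hd : DifferentiableAt ℝ (fun z => fderiv ℝ f z (e i)) y :=
        (((hf.fderiv_right (m := 1) (by norm_num)).clm_apply contDiff_const).differentiable
          (by simp)) _
      have := (L.hasFDerivAt.comp y hd.hasFDerivAt).fderiv
      exact congrArg (fun T => T (e i)) this
    rw [Finset.sum_congr rfl fun i _ => h2 i, ← map_sum, hΔ y hy, map_zero]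
  refine (SeparatingDual.eq_zero_iff_forall_dual_eq_zero (R := ℝ) _).2 fun L => ?_
  have h1 := key L
  have h2 := key (-L)
  simp only [neg_apply] at h2
  linarith

end DiracComplex

namespace DiracComplex

/-! ### Fourier transforms of functions with integrable moments -/

open Filter Topology MeasureTheory
open scoped FourierTransform SchwartzMap RealInnerProductSpace

variable {E : Type*} [NormedAddCommGroup E] [InnerProductSpace ℝ E] [FiniteDimensional ℝ E]
  [MeasurableSpace E] [BorelSpace E]
  {F : Type*} [NormedAddCommGroup F] [NormedSpace ℂ F]
  {G : Type*} [NormedAddCommGroup G] [NormedSpace ℂ G]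

/-- All moments of `h` are integrable. -/
def HasMoments (h : E → F) : Prop :=
  AEStronglyMeasurable h ∧ ∀ k : ℕ, Integrable fun ξ => ‖ξ‖ ^ k * ‖h ξ‖

namespace HasMoments

variable {h : E → F}

theorem integrable (hh : HasMoments h) : Integrable h :=
  (integrable_norm_iff hh.1).1 (by simpa using hh.2 0)

theorem contDiff (hh : HasMoments h) : ContDiff ℝ ∞ (𝓕 h) :=
  Real.contDiff_fourier (N := ⊤) fun k _ => hh.2 k

theorem inner_smul (hh : HasMoments h) (c : ℂ) (v : E) :
    HasMoments fun ξ => (c * (⟪ξ, v⟫ : ℝ)) • h ξ := by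
  have hm : AEStronglyMeasurable (fun ξ : E => (c * (⟪ξ, v⟫ : ℝ)) • h ξ) := by
    refine AEStronglyMeasurable.smul ?_ hh.1
    exact (continuous_const.mul
      (Complex.continuous_ofReal.comp (continuous_id.inner continuous_const))).aestronglyMeasurable
  refine ⟨hm, fun k => ?_⟩
  refine ((hh.2 (k + 1)).const_mul (‖c‖ * ‖v‖)).mono'
    (((continuous_norm.pow k).aestronglyMeasurable).mul hm.norm) (ae_of_all _ fun ξ => ?_)
  rw [norm_mul, norm_pow, norm_norm, norm_norm, norm_smul, norm_mul, Complex.norm_real]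
  calc ‖ξ‖ ^ k * (‖c‖ * ‖(⟪ξ, v⟫ : ℝ)‖ * ‖h ξ‖) ≤ ‖ξ‖ ^ k * (‖c‖ * (‖ξ‖ * ‖v‖) * ‖h ξ‖) := by
        gcongr
        exact norm_inner_le_norm ξ v
    _ = _ := by ring

theorem fderiv_fourier_apply (hh : HasMoments h) (x v : E) :
    fderiv ℝ (𝓕 h) x v = 𝓕 (fun ξ => (-(2 * Real.pi * Complex.I) * (⟪ξ, v⟫ : ℝ)) • h ξ) x := by
  have h1 : Integrable fun ξ => ‖ξ‖ * ‖h ξ‖ := by simpa using hh.2 1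
  rw [Real.fderiv_fourier hh.integrable h1, Real.fourier_continuousLinearMap_apply]
  · refine congrArg (fun u : E → F => 𝓕 u x) (funext fun ξ => ?_)
    rw [VectorFourier.fourierSMulRight_apply, mul_smul, neg_smul, neg_smul, innerSL_apply_apply,
      Complex.coe_smul]
  · refine (h1.const_mul (2 * Real.pi * ‖innerSL ℝ (E := E)‖)).mono'
      hh.1.fourierSMulRight (ae_of_all _ fun ξ => ?_)
    exact (VectorFourier.norm_fourierSMulRight_le (innerSL ℝ) h ξ).trans (le_of_eq (by ring))

theorem tendsto_fourier (h : E → F) : Tendsto (𝓕 h) (cocompact E) (𝓝 0) :=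
  tendsto_integral_exp_inner_smul_cocompact h

theorem clm_comp (hh : HasMoments h) (L : F →L[ℂ] G) : HasMoments fun ξ => L (h ξ) := by
  have hm := L.continuous.comp_aestronglyMeasurable hh.1
  refine ⟨hm, fun k => ((hh.2 k).const_mul ‖L‖).mono'
    (((continuous_norm.pow k).aestronglyMeasurable).mul hm.norm) (ae_of_all _ fun ξ => ?_)⟩
  rw [norm_mul, norm_pow, norm_norm, norm_norm]
  calc ‖ξ‖ ^ k * ‖L (h ξ)‖ ≤ ‖ξ‖ ^ k * (‖L‖ * ‖h ξ‖) := by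
        gcongr
        exact L.le_opNorm _
    _ = _ := by ring

end HasMoments

theorem fourier_clm_comp [CompleteSpace F] [CompleteSpace G] {h : E → F} (hh : Integrable h)
    (L : F →L[ℂ] G) (x : E) :
    𝓕 (fun ξ => L (h ξ)) x = L (𝓕 h x) := by
  rw [Real.fourier_eq, Real.fourier_eq, ← L.integral_comp_comm]
  · simp [Circle.smul_def]
  · exact (Real.fourierIntegral_convergent_iff x).2 hh

/-- In polar coordinates the weight y ^ (dim - 1) absorbs the pole since dim ≥ 2, and the integrand
is at most (1 + y)⁻². -/
theorem integrable_inv_norm_mul_one_add_norm_pow (hE : 2 ≤ Module.finrank ℝ E) :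
    Integrable fun ξ : E => ‖ξ‖⁻¹ * ((1 + ‖ξ‖) ^ Module.finrank ℝ E)⁻¹ := by
  have : Nontrivial E := Module.nontrivial_of_finrank_pos (R := ℝ) (by omega)
  refine (integrable_fun_norm_addHaar volume
    (f := fun y : ℝ => y⁻¹ * ((1 + y) ^ Module.finrank ℝ E)⁻¹)).2 ?_
  obtain ⟨d, hd⟩ : ∃ d, Module.finrank ℝ E = d + 2 := ⟨_, (Nat.sub_add_cancel hE).symm⟩
  rw [hd]
  have hI : Integrable fun y : ℝ => (1 + ‖y‖) ^ (-(2 : ℝ)) :=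
    integrable_one_add_norm (by simp)
  refine Integrable.mono' hI.integrableOn ?_ ?_
  · refine Measurable.aestronglyMeasurable ?_
    fun_prop
  · refine (ae_restrict_iff' measurableSet_Ioi).2 (ae_of_all _ fun y hy => ?_)
    have hy : 0 < y := hy
    rw [Real.norm_of_nonneg (by rw [smul_eq_mul]; positivity), Real.norm_of_nonneg hy.le,
      Real.rpow_neg (by positivity), show (2 : ℝ) = (2 : ℕ) by norm_num, Real.rpow_natCast,
      smul_eq_mul]
    have h1 : y ^ (d + 2 - 1) = y ^ d * y := by rw [show d + 2 - 1 = d + 1 by omega, pow_succ]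
    rw [h1, pow_add]
    calc y ^ d * y * (y⁻¹ * ((1 + y) ^ d * (1 + y) ^ 2)⁻¹)
        = (y ^ d * ((1 + y) ^ d)⁻¹) * ((1 + y) ^ 2)⁻¹ := by
          field_simp
      _ ≤ 1 * ((1 + y) ^ 2)⁻¹ := by
          gcongr
          rw [← div_eq_mul_inv, div_le_one (by positivity)]
          gcongr
          linarith
      _ = _ := one_mul _

theorem hasMoments_schwartz (g : 𝓢(E, F)) : HasMoments (g : E → F) :=
  ⟨g.continuous.aestronglyMeasurable, g.integrable_pow_mul volume⟩

/-- A Schwartz function times a function with a pole of order one at the origin has integrable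
moments, with a bound by Schwartz seminorms. -/
theorem norm_mul_schwartz_le (g : 𝓢(E, F)) (k M : ℕ) (ξ : E) :
    ‖ξ‖⁻¹ * (1 + ‖ξ‖) ^ k * ‖g ξ‖ ≤
      (2 ^ (k + M) * (Finset.Iic (k + M, 0)).sup (schwartzSeminormFamily ℂ E F) g) *
        (‖ξ‖⁻¹ * ((1 + ‖ξ‖) ^ M)⁻¹) := by
  have h := SchwartzMap.one_add_le_sup_seminorm_apply (𝕜 := ℂ) (m := (k + M, 0)) (k := k + M)
    (n := 0) le_rfl le_rfl g ξ
  rw [norm_iteratedFDeriv_zero] at h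
  calc ‖ξ‖⁻¹ * (1 + ‖ξ‖) ^ k * ‖g ξ‖
      = ((1 + ‖ξ‖) ^ (k + M) * ‖g ξ‖) * (‖ξ‖⁻¹ * ((1 + ‖ξ‖) ^ M)⁻¹) := by
        have : (1 + ‖ξ‖) ^ M ≠ 0 := by positivity
        field_simp
        ring
    _ ≤ _ := mul_le_mul_of_nonneg_right h (by positivity)

/-- The decay of g beats every power at infinity, and the simple pole at the origin is integrable in
dimension at least two. -/
theorem hasMoments_of_le_schwartz (hE : 2 ≤ Module.finrank ℝ E) {h : E → F}
    (hm : AEStronglyMeasurable h) (g : 𝓢(E, G)) (C : ℝ) (k : ℕ)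
    (hle : ∀ ξ, ‖h ξ‖ ≤ C * (‖ξ‖⁻¹ * (1 + ‖ξ‖) ^ k * ‖g ξ‖)) : HasMoments h := by
  refine ⟨hm, fun l => ?_⟩
  refine (((integrable_inv_norm_mul_one_add_norm_pow hE).const_mul (2 ^ ((k + l) + Module.finrank ℝ E) *
    (Finset.Iic ((k + l) + Module.finrank ℝ E, 0)).sup (schwartzSeminormFamily ℂ E G) g)).const_mul
    |C|).mono' (((continuous_norm.pow l).aestronglyMeasurable).mul hm.norm)
    (ae_of_all _ fun ξ => ?_)
  rw [norm_mul, norm_pow, norm_norm, norm_norm]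
  calc ‖ξ‖ ^ l * ‖h ξ‖ ≤ (1 + ‖ξ‖) ^ l * (|C| * (‖ξ‖⁻¹ * (1 + ‖ξ‖) ^ k * ‖g ξ‖)) := by
        gcongr
        · linarith
        · exact (hle ξ).trans (by gcongr; exact le_abs_self C)
    _ = |C| * (‖ξ‖⁻¹ * (1 + ‖ξ‖) ^ (k + l) * ‖g ξ‖) := by rw [pow_add]; ring
    _ ≤ _ := mul_le_mul_of_nonneg_left (norm_mul_schwartz_le g (k + l) _ ξ) (abs_nonneg C)

end DiracComplex

namespace DiracComplex

/-! ### Symbols and first order operators -/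

open Filter Topology MeasureTheory
open scoped FourierTransform SchwartzMap RealInnerProductSpace

section Symbol

variable {n : ℕ} {V W : Type*} [NormedAddCommGroup V] [NormedSpace ℂ V]
  [NormedAddCommGroup W] [NormedSpace ℂ W]

/-- The symbol of `∑ i, c i ∂_i`. -/
def symbol (c : Fin 2 × Fin n → V →L[ℂ] W) (ξ : Dom n) : V →L[ℂ] W := ∑ i, (ξ i : ℂ) • c i

theorem symbol_apply (c : Fin 2 × Fin n → V →L[ℂ] W) (ξ : Dom n) (v : V) :
    symbol c ξ v = ∑ i, (ξ i : ℂ) • c i v := by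
  simp [symbol, sum_apply]

theorem continuous_symbol (c : Fin 2 × Fin n → V →L[ℂ] W) : Continuous (symbol c) := by
  unfold symbol
  fun_prop

theorem norm_symbol_le (c : Fin 2 × Fin n → V →L[ℂ] W) (ξ : Dom n) :
    ‖symbol c ξ‖ ≤ (∑ i, ‖c i‖) * ‖ξ‖ := by
  rw [Finset.sum_mul]
  refine (norm_sum_le _ _).trans (Finset.sum_le_sum fun i _ => ?_)
  rw [norm_smul, Complex.norm_real, mul_comm]
  gcongr
  exact PiLp.norm_apply_le ξ i

theorem inner_coordVec (ξ : Dom n) (i : Fin 2 × Fin n) : ⟪ξ, coordVec n i⟫ = ξ i := by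
  simp [coordVec, EuclideanSpace.inner_single_right]

theorem coordVec_ne_zero (i : Fin 2 × Fin n) : coordVec n i ≠ 0 := by
  simp [coordVec]

theorem ofReal_norm_sq (ξ : Dom n) : ((‖ξ‖ : ℂ)) ^ 2 = ∑ i, (ξ i : ℂ) * (ξ i : ℂ) := by
  rw [← Complex.ofReal_pow, EuclideanSpace.norm_sq_eq]
  simp [sq]

theorem symbol_comp_of_clifford {c : Fin 2 × Fin n → V →L[ℂ] W} {d : Fin 2 × Fin n → W →L[ℂ] V}
    (h : ∀ i k u, d i (c k u) + d k (c i u) = if i = k then (2 : ℂ) • u else 0)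
    (ξ : Dom n) (u : V) : symbol d ξ (symbol c ξ u) = (‖ξ‖ : ℂ) ^ 2 • u := by
  have h1 := sum_clifford (C := fun i k u => d i (c k u)) h
    (b := fun i k => ((ξ i : ℂ) * (ξ k : ℂ)) • u) fun i k => by rw [mul_comm]
  rw [ofReal_norm_sq, Finset.sum_smul, ← h1, symbol_apply d]
  refine Finset.sum_congr rfl fun i _ => ?_
  rw [symbol_apply c, map_sum, Finset.smul_sum]
  refine Finset.sum_congr rfl fun k _ => ?_
  simp only [map_smul, smul_smul]

theorem symbol_diracAdjCoeff_comp (ξ : Dom n) (u : V0 n) :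
    symbol (diracAdjCoeff n) ξ (symbol (diracCoeff n) ξ u) = (‖ξ‖ : ℂ) ^ 2 • u :=
  symbol_comp_of_clifford (diracAdjCoeff_clifford n) ξ u

theorem HasMoments.sum_fderiv_fourier [CompleteSpace V] [CompleteSpace W] {h : Dom n → V}
    (hh : HasMoments h) (c : Fin 2 × Fin n → V →L[ℂ] W) (x : Dom n) :
    ∑ i, c i (fderiv ℝ (𝓕 h) x (coordVec n i)) =
      𝓕 (fun ξ => (-(2 * Real.pi * Complex.I)) • symbol c ξ (h ξ)) x := by
  have hi : ∀ i, Integrable fun ξ : Dom n =>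
      c i ((-(2 * Real.pi * Complex.I) * (⟪ξ, coordVec n i⟫ : ℝ)) • h ξ) := fun i =>
    ((hh.inner_smul _ _).clm_comp (c i)).integrable
  calc ∑ i, c i (fderiv ℝ (𝓕 h) x (coordVec n i))
      = ∑ i, 𝓕 (fun ξ => c i ((-(2 * Real.pi * Complex.I) * (⟪ξ, coordVec n i⟫ : ℝ)) • h ξ)) x :=
        Finset.sum_congr rfl fun i _ => by
          rw [hh.fderiv_fourier_apply, fourier_clm_comp (hh.inner_smul _ _).integrable]
    _ = 𝓕 (fun ξ => ∑ i, c i ((-(2 * Real.pi * Complex.I) * (⟪ξ, coordVec n i⟫ : ℝ)) • h ξ)) x := by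
        simp only [Real.fourier_eq, Finset.smul_sum]
        rw [integral_finsetSum]
        exact fun i _ => (Real.fourierIntegral_convergent_iff x).2 (hi i)
    _ = _ := by
        refine congrArg (fun u : Dom n → W => 𝓕 u x) (funext fun ξ => ?_)
        simp only [symbol_apply, Finset.smul_sum, inner_coordVec, map_smul, mul_smul]

/-- The operator `∑ i, c i ∂_i` on Schwartz functions. -/
def schwartzOp (c : Fin 2 × Fin n → V →L[ℂ] W) (θ : 𝓢(Dom n, V)) : 𝓢(Dom n, W) :=
  ∑ i, SchwartzMap.postcompCLM (c i) (LineDeriv.lineDerivOp (coordVec n i) θ)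

theorem schwartzOp_apply (c : Fin 2 × Fin n → V →L[ℂ] W) (θ : 𝓢(Dom n, V)) (x : Dom n) :
    schwartzOp c θ x = ∑ i, c i (fderiv ℝ θ x (coordVec n i)) := by
  simp [schwartzOp, sum_apply, SchwartzMap.lineDerivOp_apply_eq_fderiv]

/-- With θ = 𝓕(𝓕⁻θ), differentiation under the integral displays `schwartzOp c θ` as 𝓕 of a
continuous integrable function, which Fourier inversion recovers. Since 𝓕⁻ is used, ∂_i becomes
-2πiξ_i. -/
theorem fourierInv_schwartzOp [CompleteSpace V] [CompleteSpace W]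
    (c : Fin 2 × Fin n → V →L[ℂ] W) (θ : 𝓢(Dom n, V)) (ξ : Dom n) :
    𝓕⁻ (schwartzOp c θ) ξ = (-(2 * Real.pi * Complex.I)) • symbol c ξ (𝓕⁻ θ ξ) := by
  have hm : HasMoments (𝓕⁻ θ : 𝓢(Dom n, V)) := hasMoments_schwartz _
  have h1 : 𝓕 (fun ξ => (-(2 * Real.pi * Complex.I)) • symbol c ξ (𝓕⁻ θ ξ)) =
      schwartzOp c θ := by
    funext x
    rw [← hm.sum_fderiv_fourier c x, schwartzOp_apply, ← SchwartzMap.fourier_coe,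
      FourierTransform.fourier_fourierInv_eq]
  have hc : Continuous fun ξ => (-(2 * Real.pi * Complex.I)) • symbol c ξ (𝓕⁻ θ ξ) :=
    ((continuous_symbol c).clm_apply (𝓕⁻ θ : 𝓢(Dom n, V)).continuous).const_smul _
  have hi : Integrable fun ξ => (-(2 * Real.pi * Complex.I)) • symbol c ξ (𝓕⁻ θ ξ) := by
    have h2 : (fun ξ => (-(2 * Real.pi * Complex.I)) • symbol c ξ (𝓕⁻ θ ξ)) = fun ξ => ∑ i,
        c i ((-(2 * Real.pi * Complex.I) * (⟪ξ, coordVec n i⟫ : ℝ)) • 𝓕⁻ θ ξ) := by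
      funext ξ
      simp only [symbol_apply, Finset.smul_sum, inner_coordVec, map_smul, mul_smul]
    rw [h2]
    exact integrable_finsetSum _ fun i _ => ((hm.inner_smul _ _).clm_comp (c i)).integrable
  have h3 := hc.fourierInv_fourier_eq hi (by rw [h1]; exact (schwartzOp c θ).integrable)
  rw [h1, ← SchwartzMap.fourierInv_coe] at h3
  exact congrFun h3 ξ

end Symbol

/-! ### Symmetry of second derivatives. -/

section DerivSymm

variable {E F : Type*} [NormedAddCommGroup E] [NormedSpace ℝ E] [NormedAddCommGroup F]
  [NormedSpace ℝ F]

theorem fderiv_fderiv_apply {f : E → F} (hf : ContDiff ℝ 2 f) (x v w : E) :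
    fderiv ℝ (fun z => fderiv ℝ f z v) x w = fderiv ℝ (fderiv ℝ f) x w v := by
  have hd : DifferentiableAt ℝ (fderiv ℝ f) x :=
    ((hf.fderiv_right (m := 1) (by norm_num)).differentiable (by simp)) x
  rw [fderiv_clm_apply hd (differentiableAt_const v)]
  simp

theorem fderiv_fderiv_comm {f : E → F} (hf : ContDiff ℝ 2 f) (x v w : E) :
    fderiv ℝ (fun z => fderiv ℝ f z v) x w = fderiv ℝ (fun z => fderiv ℝ f z w) x v := by
  rw [fderiv_fderiv_apply hf, fderiv_fderiv_apply hf]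
  exact hf.contDiffAt.isSymmSndFDerivAt (by simp) w v

end DerivSymm

/-! ### Vanishing on the planes where one group of variables is constant. -/

section Test

variable {n : ℕ}

theorem sum_sq_coord_le (x : Dom n) (B : Fin 2) : ∑ j, x (B, j) ^ 2 ≤ ‖x‖ ^ 2 := by
  rw [EuclideanSpace.norm_sq_eq, Fintype.sum_prod_type]
  refine (le_of_eq ?_).trans (Finset.single_le_sum
    (f := fun A => ∑ j, ‖x (A, j)‖ ^ 2) (fun A _ => by positivity) (Finset.mem_univ B))
  simp

theorem coordVec_apply_of_ne {A B : Fin 2} (h : A ≠ B) (j k : Fin n) :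
    coordVec n (A, j) (B, k) = 0 := by
  simp [coordVec, h.symm]

/-- If `f` vanishes at infinity and `∑ j, γ_j ∂_{Aj} f = 0` wherever `|x_B|` is large, then
`f` vanishes there. -/
theorem eq_zero_of_dirac_eq_zero (hn : 0 < n) {A B : Fin 2} (hAB : A ≠ B) {f : Dom n → V0 n}
    (hf : ContDiff ℝ ∞ f) (h0 : Tendsto f (cocompact (Dom n)) (𝓝 0)) {r : ℝ}
    (hD : ∀ x : Dom n, r < ∑ j, x (B, j) ^ 2 →
      ∑ j, gammaPlus n j (fderiv ℝ f x (coordVec n (A, j))) = 0)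
    {x : Dom n} (hx : r < ∑ j, x (B, j) ^ 2) : f x = 0 := by
  have : Nonempty (Fin n) := ⟨⟨0, hn⟩⟩
  have hf2 : ContDiff ℝ 2 f := hf.of_le (by norm_cast)
  -- Liouville on the n-plane through x with x_B fixed: it lies entirely in the region where the
  -- equation holds.
  refine eq_zero_of_harmonic_of_tendsto_zero (e := fun j => coordVec n (A, j))
    (fun j => coordVec_ne_zero _) (A := {y : Dom n | ∀ k, y (B, k) = x (B, k)})
    ?_ ?_ hf2 h0 ?_ x fun k => rfl
  · simp only [Set.ofPred_forall]
    exact isClosed_iInter fun k => isClosed_eq (by fun_prop) continuous_const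
  · intro y hy i t k
    simp [coordVec_apply_of_ne hAB, hy k]
  · intro y hy
    have hd : ∀ k, DifferentiableAt ℝ (fun z => fderiv ℝ f z (coordVec n (A, k))) y := fun k =>
      ((hf2.fderiv_right (m := 1) (by norm_num)).clm_apply contDiff_const).differentiable
        (by simp) y
    have hev : (fun z => ∑ k, gammaPlus n k (fderiv ℝ f z (coordVec n (A, k)))) =ᶠ[𝓝 y]
        fun _ => 0 := by
      have hopen : IsOpen {z : Dom n | r < ∑ j, z (B, j) ^ 2} :=
        isOpen_lt continuous_const (by fun_prop)
      have hmem : y ∈ {z : Dom n | r < ∑ j, z (B, j) ^ 2} := by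
        have hy : ∀ k, y (B, k) = x (B, k) := hy
        simpa [hy] using hx
      filter_upwards [hopen.mem_nhds hmem] with z hz using hD z hz
    have h1 : ∀ j, ∑ k, gammaPlus n k
        (fderiv ℝ (fun z => fderiv ℝ f z (coordVec n (A, k))) y (coordVec n (A, j))) = 0 := by
      intro j
      have h2 : HasFDerivAt (fun z => ∑ k, gammaPlus n k (fderiv ℝ f z (coordVec n (A, k))))
          (∑ k, ((gammaPlus n k).restrictScalars ℝ).comp
            (fderiv ℝ (fun z => fderiv ℝ f z (coordVec n (A, k))) y)) y :=
        HasFDerivAt.fun_sum fun k _ =>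
          ((gammaPlus n k).restrictScalars ℝ).hasFDerivAt.comp y (hd k).hasFDerivAt
      have h3 := h2.fderiv
      rw [hev.fderiv_eq] at h3
      have h4 := congrArg (fun T => T (coordVec n (A, j))) h3
      simpa [sum_apply] using h4.symm
    -- The adjoint Dirac operator in x_A, applied to the equation, gives the Laplacian in x_A.
    have h5 := sum_clifford (C := fun j k u => gammaAdj n j (gammaPlus n k u))
      (gammaAdj_clifford n)
      (b := fun j k => fderiv ℝ (fun z => fderiv ℝ f z (coordVec n (A, k))) y (coordVec n (A, j)))
      fun j k => fderiv_fderiv_comm hf2 _ _ _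
    rw [← h5]
    refine Finset.sum_eq_zero fun j _ => ?_
    rw [← map_sum, h1, map_zero]

end Test

end DiracComplex

namespace DiracComplex

/-! ### The range on test functions -/

open Filter Topology MeasureTheory
open scoped FourierTransform SchwartzMap RealInnerProductSpace

theorem finrank_dom (n : ℕ) : Module.finrank ℝ (Dom n) = 2 * n := by
  simp

/-- The multiplier `‖ξ‖⁻² ∑ ξ_i d_i`, homogeneous of degree `-1`. -/
def homogMultiplier {n : ℕ} {V W : Type*} [NormedAddCommGroup V] [NormedSpace ℂ V]
    [NormedAddCommGroup W] [NormedSpace ℂ W] (d : Fin 2 × Fin n → V →L[ℂ] W) (ξ : Dom n) :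
    V →L[ℂ] W :=
  (((‖ξ‖ : ℂ)) ^ 2)⁻¹ • symbol d ξ

section Multiplier

variable {n : ℕ} {V W : Type*} [NormedAddCommGroup V] [NormedSpace ℂ V]
  [NormedAddCommGroup W] [NormedSpace ℂ W] (d : Fin 2 × Fin n → V →L[ℂ] W)

theorem norm_homogMultiplier_le (ξ : Dom n) :
    ‖homogMultiplier d ξ‖ ≤ (∑ i, ‖d i‖) * ‖ξ‖⁻¹ := by
  rw [homogMultiplier, norm_smul, norm_inv, norm_pow, Complex.norm_real, norm_norm]
  -- At the origin both sides vanish, because 0⁻¹ = 0.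
  rcases eq_or_ne ξ 0 with rfl | hξ
  · simp
  · have : ‖ξ‖ ≠ 0 := norm_ne_zero_iff.2 hξ
    calc (‖ξ‖ ^ 2)⁻¹ * ‖symbol d ξ‖ ≤ (‖ξ‖ ^ 2)⁻¹ * ((∑ i, ‖d i‖) * ‖ξ‖) := by
          gcongr
          exact norm_symbol_le d ξ
      _ = _ := by field_simp

theorem stronglyMeasurable_homogMultiplier : StronglyMeasurable (homogMultiplier d) := by
  have h : Measurable fun ξ : Dom n => (((‖ξ‖ : ℂ)) ^ 2)⁻¹ := by fun_prop
  exact h.stronglyMeasurable.smul (continuous_symbol d).stronglyMeasurable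

theorem hasMoments_homogMultiplier (hn : 0 < n) (g : 𝓢(Dom n, V)) :
    HasMoments fun ξ => homogMultiplier d ξ (g ξ) := by
  refine hasMoments_of_le_schwartz (by rw [finrank_dom]; omega) ?_ g (∑ i, ‖d i‖) 0 fun ξ => ?_
  · exact (ContinuousLinearMap.apply ℂ W).flip.aestronglyMeasurable_comp₂
      (stronglyMeasurable_homogMultiplier d).aestronglyMeasurable g.continuous.aestronglyMeasurable
  · refine ((homogMultiplier d ξ).le_opNorm _).trans ?_
    rw [pow_zero, mul_one, ← mul_assoc]
    gcongr
    exact norm_homogMultiplier_le d ξ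

end Multiplier

theorem ae_ne_zero {n : ℕ} (hn : 0 < n) : ∀ᵐ ξ : Dom n, ξ ≠ 0 := by
  have : Nontrivial (Dom n) :=
    Module.nontrivial_of_finrank_pos (R := ℝ) (by rw [finrank_dom]; omega)
  exact Measure.ae_ne volume 0

/-- The test functions of a space as Schwartz functions. -/
def testToSchwartz {n : ℕ} {V : Type} [NormedAddCommGroup V] [NormedSpace ℂ V]
    (f : TestSpace n V) : 𝓢(Dom n, V) :=
  f.hasCompactSupport.toSchwartzMap f.contDiff

/-- For fixed ξ this is the pairing with a character, a locally integrable function, hence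
continuous on test functions. -/
theorem continuous_fourierInv_test (n : ℕ) (ξ : Dom n) :
    Continuous fun g : TestSpace n (V1 n) => 𝓕⁻ (g : Dom n → V1 n) ξ := by
  have hloc : LocallyIntegrableOn (fun v : Dom n => ((Real.fourierChar ⟪v, ξ⟫ : Circle) : ℂ))
      ((⊤ : TopologicalSpace.Opens (Dom n)) : Set (Dom n)) volume := by
    refine Continuous.locallyIntegrable ?_ |>.locallyIntegrableOn _
    exact continuous_subtype_val.comp (Real.continuous_fourierChar.comp
      (continuous_id.inner continuous_const))
  refine (TestFunction.integralAgainstBilinCLM (Ω := (⊤ : TopologicalSpace.Opens (Dom n)))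
    (n := ⊤) (ContinuousLinearMap.lsmul ℂ ℂ (E := V1 n)).flip volume
    fun v : Dom n => ((Real.fourierChar ⟪v, ξ⟫ : Circle) : ℂ)).continuous.congr fun g => ?_
  rw [TestFunction.integralAgainstBilinCLM_eq_integral hloc, Real.fourierInv_eq]
  rfl

/-- The algebraic condition on the Fourier transform that characterizes the range of `𝒟₀`. -/
def FourierCompatible (n : ℕ) (g : TestSpace n (V1 n)) : Prop :=
  ∀ ξ : Dom n, symbol (diracCoeff n) ξ (symbol (diracAdjCoeff n) ξ (𝓕⁻ (g : Dom n → V1 n) ξ)) =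
    (‖ξ‖ : ℂ) ^ 2 • 𝓕⁻ (g : Dom n → V1 n) ξ

theorem isClosed_fourierCompatible (n : ℕ) : IsClosed {g | FourierCompatible n g} := by
  simp only [FourierCompatible, Set.ofPred_forall]
  refine isClosed_iInter fun ξ => isClosed_eq ?_ ?_
  · exact ((symbol (diracCoeff n) ξ).comp (symbol (diracAdjCoeff n) ξ)).continuous.comp
      (continuous_fourierInv_test n ξ)
  · exact (continuous_fourierInv_test n ξ).const_smul ((‖ξ‖ : ℂ) ^ 2)

theorem diracTest_eq_sum (n : ℕ) (f : TestSpace n (V0 n)) (x : Dom n) :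
    diracTest n f x = ∑ i, diracCoeff n i (fderiv ℝ f x (coordVec n i)) := by
  funext A
  rw [diracTest_apply, Finset.sum_apply, Fintype.sum_prod_type, Finset.sum_eq_single A]
  · simp [diracCoeff]
  · intro B _ hB
    simp [diracCoeff, Pi.single_eq_of_ne hB.symm]
  · simp

/-- Here 𝓕⁻g = -2πi c(ξ)𝓕⁻f, and c(ξ)a(ξ)c(ξ) = |ξ|²c(ξ). -/
theorem fourierCompatible_diracTest (n : ℕ) (f : TestSpace n (V0 n)) :
    FourierCompatible n (diracTest n f) := by
  intro ξ
  have h1 : (diracTest n f : Dom n → V1 n) = schwartzOp (diracCoeff n) (testToSchwartz f) := by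
    funext x
    rw [schwartzOp_apply, diracTest_eq_sum]
    rfl
  rw [h1, ← SchwartzMap.fourierInv_coe, fourierInv_schwartzOp, map_smul,
    symbol_diracAdjCoeff_comp, map_smul, map_smul, smul_comm]

/-- Compatibility makes the left inverse of the symbol a right inverse on 𝓕⁻g for ξ ≠ 0. The
resulting solution 𝓕 h is smooth and vanishes at infinity; the Liouville argument on planes bounds
its support. -/
theorem mem_range_diracTest (n : ℕ) (hn : 0 < n) (g : TestSpace n (V1 n))
    (hg : FourierCompatible n g) : ∃ f, diracTest n f = g := by
  set G : 𝓢(Dom n, V1 n) := testToSchwartz g with hG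
  have hGg : (G : Dom n → V1 n) = g := rfl
  set h : Dom n → V0 n := fun ξ =>
    (-(2 * Real.pi * Complex.I))⁻¹ • homogMultiplier (diracAdjCoeff n) ξ (𝓕⁻ G ξ) with hh
  have hm : HasMoments h := by
    exact (hasMoments_homogMultiplier (diracAdjCoeff n) hn (𝓕⁻ G)).clm_comp
      ((-(2 * Real.pi * Complex.I))⁻¹ • ContinuousLinearMap.id ℂ (V0 n))
  have hpi : (-(2 * Real.pi * Complex.I)) ≠ 0 := by simp [Real.pi_ne_zero]
  have hfd : ∀ x, ∑ i, diracCoeff n i (fderiv ℝ (𝓕 h) x (coordVec n i)) = g x := by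
    intro x
    rw [hm.sum_fderiv_fourier]
    have h1 : (fun ξ => (-(2 * Real.pi * Complex.I)) • symbol (diracCoeff n) ξ (h ξ)) =ᵐ[volume]
        (𝓕⁻ G : 𝓢(Dom n, V1 n)) := by
      filter_upwards [ae_ne_zero hn] with ξ hξ
      have h2 := hg ξ
      rw [← hGg, ← SchwartzMap.fourierInv_coe] at h2
      have hξ' : ((‖ξ‖ : ℂ)) ^ 2 ≠ 0 := by simpa using hξ
      simp only [hh, homogMultiplier, smul_apply, map_smul, h2, smul_smul]
      rw [inv_mul_cancel_right₀ hξ', mul_inv_cancel₀ hpi, one_smul]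
    calc 𝓕 (fun ξ => (-(2 * Real.pi * Complex.I)) • symbol (diracCoeff n) ξ (h ξ)) x
        = 𝓕 ((𝓕⁻ G : 𝓢(Dom n, V1 n)) : Dom n → V1 n) x := by
          rw [Real.fourier_eq, Real.fourier_eq]
          refine integral_congr_ae (h1.mono fun ξ hξ => ?_)
          simp only at hξ ⊢
          rw [hξ]
      _ = g x := by
          rw [← SchwartzMap.fourier_coe, FourierTransform.fourier_fourierInv_eq]
          rfl
  obtain ⟨R, hR⟩ : ∃ R, ∀ x, R < ‖x‖ → g x = 0 := by
    obtain ⟨R, hR⟩ := g.hasCompactSupport.isCompact.isBounded.exists_norm_le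
    exact ⟨R, fun x hx => image_eq_zero_of_notMem_tsupport fun hxs => (hR x hxs).not_gt hx⟩
  have hfA : ∀ A x, R ^ 2 < ∑ j, x (A, j) ^ 2 →
      ∀ B, ∑ j, gammaPlus n j (fderiv ℝ (𝓕 h) x (coordVec n (B, j))) = 0 := by
    intro A x hx B
    have hx' : R < ‖x‖ := lt_of_pow_lt_pow_left₀ 2 (norm_nonneg x)
      (hx.trans_le (sum_sq_coord_le x A))
    have h1 := congrFun ((hfd x).trans (hR x hx')) B
    rw [Finset.sum_apply, Fintype.sum_prod_type, Finset.sum_eq_single B] at h1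
    · simpa [diracCoeff] using h1
    · intro C _ hC
      simp [diracCoeff, Pi.single_eq_of_ne hC.symm]
    · simp
  -- One of |x_0|², |x_1|² exceeds R²; harmonicity is used in the other group of variables.
  have hsupp : ∀ x, 2 * R ^ 2 < ‖x‖ ^ 2 → 𝓕 h x = 0 := by
    intro x hx
    rw [EuclideanSpace.norm_sq_eq, Fintype.sum_prod_type, Fin.sum_univ_two] at hx
    simp only [Real.norm_eq_abs, sq_abs] at hx
    by_cases h0 : R ^ 2 < ∑ j, x (0, j) ^ 2
    · exact eq_zero_of_dirac_eq_zero hn (A := 1) (B := 0) (by simp) hm.contDiff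
        (HasMoments.tendsto_fourier h) (fun y hy => hfA 0 y hy 1) h0
    · exact eq_zero_of_dirac_eq_zero hn (A := 0) (B := 1) (by simp) hm.contDiff
        (HasMoments.tendsto_fourier h) (fun y hy => hfA 1 y hy 0) (by linarith)
  have hcs : HasCompactSupport (𝓕 h) := by
    -- The absolute value is needed since R may be negative; (2|R|)² = 4R² ≥ 2R² suffices.
    refine HasCompactSupport.intro (isCompact_closedBall (0 : Dom n) (2 * |R|)) fun x hx => ?_
    refine hsupp x ?_
    have h1 : 2 * |R| < ‖x‖ := by simpa using hx
    have h2 : (2 * |R|) ^ 2 < ‖x‖ ^ 2 := by gcongr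
    rw [mul_pow, sq_abs] at h2
    nlinarith [sq_nonneg R]
  refine ⟨⟨𝓕 h, hm.contDiff, hcs, by simp⟩, ?_⟩
  ext1 x
  rw [diracTest_eq_sum]
  exact hfd x

theorem isClosed_range_diracTest (n : ℕ) : IsClosed (Set.range (diracTest n)) := by
  rcases Nat.eq_zero_or_pos n with rfl | hn
  · have h : diracTest 0 = 0 := by simp [diracTest]
    rw [h]
    simp
  · convert isClosed_fourierCompatible n using 1
    ext g
    constructor
    · rintro ⟨f, rfl⟩
      exact fourierCompatible_diracTest n f
    · exact mem_range_diracTest n hn g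

end DiracComplex

namespace DiracComplex

/-! ### Compactly supported distributions and Fourier integrals -/

open Filter Topology MeasureTheory
open scoped FourierTransform SchwartzMap RealInnerProductSpace

/-- The bound makes T vanish on the kernel of J, so T descends to a bounded functional on the range
of J, which Hahn–Banach extends. -/
theorem exists_factor_of_norm_le {M X : Type*} [AddCommGroup M] [Module ℂ M]
    [NormedAddCommGroup X] [NormedSpace ℂ X] (J : M →ₗ[ℂ] X) (T : M →ₗ[ℂ] ℂ) (C : ℝ)
    (h : ∀ m, ‖T m‖ ≤ C * ‖J m‖) : ∃ T' : X →L[ℂ] ℂ, ∀ m, T m = T' (J m) := by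
  obtain ⟨g, hg⟩ := J.rangeRestrict.exists_rightInverse_of_surjective J.range_rangeRestrict
  have hg' : ∀ y : LinearMap.range J, J (g y) = y := fun y =>
    congrArg Subtype.val (LinearMap.congr_fun hg y)
  obtain ⟨T', hT', -⟩ := exists_extension_norm_eq (LinearMap.range J)
    ((T ∘ₗ g).mkContinuous C fun y => by
      have := h (g y)
      rwa [hg'] at this)
  refine ⟨T', fun m => ?_⟩
  have h1 := hT' (J.rangeRestrict m)
  have h2 : T (m - g (J.rangeRestrict m)) = 0 := by
    refine norm_le_zero_iff.1 ((h _).trans (le_of_eq ?_))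
    rw [map_sub, hg']
    simp
  rw [map_sub, sub_eq_zero] at h2
  rw [h2]
  exact h1.symm

/-! ### Factorization of compactly supported distributions through finite jets. -/

section Jets

variable {E F : Type*} [NormedAddCommGroup E] [NormedSpace ℝ E] [FiniteDimensional ℝ E]
  [NormedAddCommGroup F] [NormedSpace ℂ F]

theorem SmoothFun.tendsto_iff {X : Type*} {l : Filter X} {u : X → SmoothFun E F}
    {f : SmoothFun E F} :
    Tendsto u l (𝓝 f) ↔ ∀ k, Tendsto (fun x => SmoothFun.jet k (u x)) l (𝓝 (SmoothFun.jet k f)) := by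
  have h : 𝓝 f = ⨅ k : ℕ, comap (SmoothFun.jet k) (𝓝 (SmoothFun.jet k f)) := by
    refine nhds_iInf.trans (iInf_congr fun k => ?_)
    exact nhds_induced _ _
  rw [h, tendsto_iInf]
  exact forall_congr' fun k => tendsto_comap_iff

/-- One k serves as order, radius and bound. If every k failed with a witness φ k, then k⁻¹ φ k
would tend to 0 while |T(k⁻¹ φ k)| > 1 for k ≥ 1. -/
theorem SmoothFun.exists_bound (T : SmoothFun E F →L[ℂ] ℂ) : ∃ k : ℕ, ∀ φ : SmoothFun E F,
    (∀ j ≤ k, ∀ x ∈ Metric.closedBall (0 : E) k, ‖SmoothFun.jet j φ x‖ ≤ 1) → ‖T φ‖ ≤ k := by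
  by_contra! H
  choose φ hφ hT using H
  have hlim : Tendsto (fun k : ℕ => (k : ℂ)⁻¹ • φ k) atTop (𝓝 0) := by
    rw [SmoothFun.tendsto_iff]
    intro j
    rw [map_zero, ContinuousMap.tendsto_iff_forall_isCompact_tendstoUniformlyOn]
    intro K hK
    obtain ⟨R, hR⟩ := hK.isBounded.exists_norm_le
    rw [Metric.tendstoUniformlyOn_iff]
    intro ε hε
    filter_upwards [eventually_ge_atTop j, eventually_ge_atTop ⌈R⌉₊,
      (tendsto_inv_atTop_nhds_zero_nat (𝕜 := ℝ)).eventually (gt_mem_nhds hε)] with k hk1 hk2 hk3 x hx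
    have h1 := hφ k j hk1 x (by
      rw [mem_closedBall_zero_iff]
      exact (hR x hx).trans ((Nat.le_ceil R).trans (by exact_mod_cast hk2)))
    rw [map_smul, dist_comm, ContinuousMap.zero_apply, dist_zero_right, ContinuousMap.smul_apply,
      norm_smul, norm_inv, Complex.norm_natCast]
    calc (k : ℝ)⁻¹ * ‖SmoothFun.jet j (φ k) x‖ ≤ (k : ℝ)⁻¹ * 1 := by gcongr
      _ < ε := by simpa using hk3
  have hT0 : Tendsto (fun k : ℕ => ‖T ((k : ℂ)⁻¹ • φ k)‖) atTop (𝓝 0) := by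
    simpa using ((T.continuous.tendsto 0).comp hlim).norm
  obtain ⟨k, hk1, hk2⟩ := ((hT0.eventually (gt_mem_nhds one_pos)).and
    (eventually_ge_atTop 1)).exists
  rw [map_smul, norm_smul, norm_inv, Complex.norm_natCast] at hk1
  have hkpos : (0 : ℝ) < k := by exact_mod_cast hk2
  rw [inv_mul_lt_iff₀ hkpos, mul_one] at hk1
  exact (hT k).not_gt hk1

variable (E F) in
/-- The space of the jets of order at most `k` over the ball of radius `k`. -/
def JetSpace (k : ℕ) : Type _ :=
  (j : Fin (k + 1)) →
    C(Metric.closedBall (0 : E) k, ContinuousMultilinearMap ℝ (fun _ : Fin j => E) F)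

instance (k : ℕ) : NormedAddCommGroup (JetSpace E F k) :=
  inferInstanceAs (NormedAddCommGroup ((j : Fin (k + 1)) →
    C(Metric.closedBall (0 : E) k, ContinuousMultilinearMap ℝ (fun _ : Fin j => E) F)))

instance (k : ℕ) : NormedSpace ℂ (JetSpace E F k) :=
  inferInstanceAs (NormedSpace ℂ ((j : Fin (k + 1)) →
    C(Metric.closedBall (0 : E) k, ContinuousMultilinearMap ℝ (fun _ : Fin j => E) F)))

instance [CompleteSpace F] (k : ℕ) : CompleteSpace (JetSpace E F k) :=
  inferInstanceAs (CompleteSpace ((j : Fin (k + 1)) →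
    C(Metric.closedBall (0 : E) k, ContinuousMultilinearMap ℝ (fun _ : Fin j => E) F)))

theorem JetSpace.norm_apply_le {k : ℕ} (u : JetSpace E F k) (j : Fin (k + 1))
    (x : Metric.closedBall (0 : E) k) : ‖u j x‖ ≤ ‖u‖ :=
  ((u j).norm_coe_le_norm x).trans (norm_le_pi_norm (G := fun j : Fin (k + 1) =>
    C(Metric.closedBall (0 : E) k, ContinuousMultilinearMap ℝ (fun _ : Fin j => E) F)) u j)

theorem JetSpace.norm_le {k : ℕ} (u : JetSpace E F k) {C : ℝ} (hC : 0 ≤ C)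
    (h : ∀ j x, ‖u j x‖ ≤ C) : ‖u‖ ≤ C :=
  (pi_norm_le_iff_of_nonneg (G := fun j : Fin (k + 1) =>
    C(Metric.closedBall (0 : E) k, ContinuousMultilinearMap ℝ (fun _ : Fin j => E) F)) hC).2
      fun j => (ContinuousMap.norm_le _ hC).2 (h j)

theorem JetSpace.ext {k : ℕ} {u v : JetSpace E F k} (h : ∀ j x, u j x = v j x) : u = v :=
  funext fun j => ContinuousMap.ext (h j)

theorem JetSpace.continuous_of_continuous_apply {X : Type*} [TopologicalSpace X] {k : ℕ}
    {u : X → JetSpace E F k}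
    (h : ∀ j, Continuous fun p : X × Metric.closedBall (0 : E) k => u p.1 j p.2) : Continuous u :=
  continuous_pi (A := fun j : Fin (k + 1) =>
    C(Metric.closedBall (0 : E) k, ContinuousMultilinearMap ℝ (fun _ : Fin j => E) F))
    fun j => ContinuousMap.continuous_of_continuous_uncurry _ (h j)

variable (F) in
/-- The evaluation of a component of a jet at a point. -/
def JetSpace.eval (k : ℕ) (j : Fin (k + 1)) (x : Metric.closedBall (0 : E) k) :
    JetSpace E F k →L[ℂ] ContinuousMultilinearMap ℝ (fun _ : Fin j => E) F :=
  LinearMap.mkContinuous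
    { toFun := fun u => u j x
      map_add' := fun _ _ => rfl
      map_smul' := fun _ _ => rfl } 1 fun u => by
        rw [one_mul]
        exact JetSpace.norm_apply_le u j x

/-- The restriction of the jet of order `k` of a smooth function to the ball of radius `k`. -/
def SmoothFun.jets (k : ℕ) : SmoothFun E F →ₗ[ℂ] JetSpace E F k where
  toFun φ j := (SmoothFun.jet j φ).restrict _
  map_add' φ ψ := by
    refine JetSpace.ext fun j x => ?_
    change SmoothFun.jet j (φ + ψ) x = SmoothFun.jet j φ x + SmoothFun.jet j ψ x
    rw [map_add]
    rfl
  map_smul' c φ := by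
    refine JetSpace.ext fun j x => ?_
    change SmoothFun.jet j (c • φ) x = c • SmoothFun.jet j φ x
    rw [map_smul]
    rfl

theorem SmoothFun.jets_apply (k : ℕ) (φ : SmoothFun E F) (j : Fin (k + 1))
    (x : Metric.closedBall (0 : E) k) :
    SmoothFun.jets k φ j x = iteratedFDeriv ℝ j φ x := rfl

/-- Every compactly supported distribution factors through a space of jets. -/
theorem SmoothFun.exists_factor_jets (T : SmoothFun E F →L[ℂ] ℂ) :
    ∃ (k : ℕ) (T' : JetSpace E F k →L[ℂ] ℂ), ∀ φ, T φ = T' (SmoothFun.jets k φ) := by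
  obtain ⟨k, hk⟩ := SmoothFun.exists_bound T
  have hscale : ∀ φ : SmoothFun E F, ∀ c : ℝ, 0 < c → ‖SmoothFun.jets k φ‖ ≤ c →
      ‖T φ‖ ≤ k * c := by
    intro φ c hc hle
    have h1 := hk (((c : ℂ))⁻¹ • φ) fun j hj x hx => by
      have h2 : ‖SmoothFun.jet j φ x‖ ≤ c :=
        (JetSpace.norm_apply_le (SmoothFun.jets k φ) ⟨j, by omega⟩ ⟨x, hx⟩).trans hle
      rw [map_smul, ContinuousMap.smul_apply, norm_smul, norm_inv, Complex.norm_real,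
        Real.norm_of_nonneg hc.le, inv_mul_le_iff₀ hc, mul_one]
      exact h2
    rwa [map_smul, norm_smul, norm_inv, Complex.norm_real, Real.norm_of_nonneg hc.le,
      inv_mul_le_iff₀ hc, mul_comm] at h1
  have hbound : ∀ φ : SmoothFun E F, ‖T φ‖ ≤ k * ‖SmoothFun.jets k φ‖ := by
    intro φ
    -- The scaling factor must be positive although the norm of the jets may vanish, hence the ε.
    refine le_of_forall_pos_le_add fun ε hε => ?_
    have h1 := hscale φ (‖SmoothFun.jets k φ‖ + ε / (k + 1)) (by positivity)
      (le_add_of_nonneg_right (by positivity))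
    refine h1.trans ?_
    rw [mul_add]
    gcongr
    rw [mul_div_assoc', div_le_iff₀ (by positivity), mul_comm]
    gcongr
    linarith
  obtain ⟨T', hT'⟩ := exists_factor_of_norm_le (X := JetSpace E F k) (SmoothFun.jets k)
    T.toLinearMap k hbound
  exact ⟨k, T', hT'⟩

/-- A compactly supported distribution vanishes on the functions that vanish near a large ball. -/
theorem SmoothFun.exists_support_bound (T : SmoothFun E F →L[ℂ] ℂ) :
    ∃ R : ℝ, 0 ≤ R ∧ ∀ (φ : SmoothFun E F) (U : Set E), IsOpen U → Metric.closedBall 0 R ⊆ U →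
      (∀ x ∈ U, φ x = 0) → T φ = 0 := by
  obtain ⟨k, T', hT'⟩ := SmoothFun.exists_factor_jets T
  refine ⟨k, by positivity, fun φ U hU hRU hφ => ?_⟩
  have h : SmoothFun.jets k φ = 0 := by
    refine JetSpace.ext fun j x => ?_
    have he : (φ : E → F) =ᶠ[𝓝 (x : E)] fun _ => 0 := by
      filter_upwards [hU.mem_nhds (hRU x.2)] with y hy using hφ y hy
    rw [SmoothFun.jets_apply, (he.iteratedFDeriv ℝ j).self_of_nhds, iteratedFDeriv_fun_zero]
    rfl
  rw [hT', h, map_zero]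

end Jets

/-! ### Plane waves, and distributions applied to Fourier integrals. -/

section Wave

variable {E F : Type*} [NormedAddCommGroup E] [InnerProductSpace ℝ E] [FiniteDimensional ℝ E]
  [MeasurableSpace E] [BorelSpace E] [NormedAddCommGroup F] [NormedSpace ℂ F]

open VectorFourier

theorem integrable_dirac_norm_pow_mul (ξ : E) (v : F) (k : ℕ) :
    Integrable (fun η : E => ‖η‖ ^ k * ‖v‖) (Measure.dirac ξ) :=
  integrable_dirac (by
    rw [← ofReal_norm]
    exact ENNReal.ofReal_lt_top)

/-- A plane wave is the Fourier integral of a constant against a point mass, so its smoothness and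
derivatives follow from those of Fourier integrals. -/
theorem fourierIntegral_dirac (ξ : E) (v : F) [CompleteSpace F] :
    fourierIntegral Real.fourierChar (Measure.dirac ξ) (innerSL ℝ (E := E)).toLinearMap₁₂
      (fun _ => v) = fun x => Real.fourierChar (-⟪ξ, x⟫) • v := by
  funext x
  rw [fourierIntegral, integral_dirac]
  rfl

variable [CompleteSpace F]

theorem contDiff_wave (ξ : E) (v : F) :
    ContDiff ℝ ∞ fun x : E => Real.fourierChar (-⟪ξ, x⟫) • v := by
  have h := contDiff_fourierIntegral (innerSL ℝ (E := E)) (μ := Measure.dirac ξ)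
    (f := fun _ => v) (N := ⊤) fun k _ => integrable_dirac_norm_pow_mul ξ v k
  rwa [fourierIntegral_dirac ξ v] at h

theorem iteratedFDeriv_wave (ξ : E) (v : F) (k : ℕ) (x : E) :
    iteratedFDeriv ℝ k (fun x : E => Real.fourierChar (-⟪ξ, x⟫) • v) x =
      Real.fourierChar (-⟪ξ, x⟫) • fourierPowSMulRight (innerSL ℝ) (fun _ => v) ξ k := by
  have h := iteratedFDeriv_fourierIntegral (innerSL ℝ (E := E)) (μ := Measure.dirac ξ)
    (f := fun _ => v) (N := ⊤) (fun k _ => integrable_dirac_norm_pow_mul ξ v k)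
    aestronglyMeasurable_const (n := k) le_top
  have h1 := congrFun h x
  rw [fourierIntegral_dirac ξ v] at h1
  refine h1.trans ?_
  exact integral_dirac (fun η => Real.fourierChar (-⟪η, x⟫) •
    fourierPowSMulRight (innerSL ℝ) (fun _ => v) η k) ξ

/-- The plane wave `x ↦ exp (-2 π i ⟪ξ, x⟫) v`. -/
def wave (ξ : E) (v : F) : SmoothFun E F := ⟨fun x => Real.fourierChar (-⟪ξ, x⟫) • v,
  contDiff_wave ξ v⟩

theorem wave_smul (ξ : E) (c : ℂ) (v : F) : wave ξ (c • v) = c • wave ξ v :=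
  SmoothFun.ext fun x => smul_comm (Real.fourierChar (-⟪ξ, x⟫)) c v

theorem jets_wave_apply (k : ℕ) (ξ : E) (v : F) (j : Fin (k + 1))
    (x : Metric.closedBall (0 : E) k) :
    SmoothFun.jets k (wave ξ v) j x =
      Real.fourierChar (-⟪ξ, x⟫) • fourierPowSMulRight (innerSL ℝ) (fun _ => v) ξ j :=
  iteratedFDeriv_wave ξ v j x

/-- Joint continuity yields the strong measurability required for the Bochner integral in
`jets_fourierSmooth`. -/
theorem continuous_jets_wave (k : ℕ) :
    Continuous fun p : E × F => SmoothFun.jets k (wave p.1 p.2) := by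
  refine JetSpace.continuous_of_continuous_apply fun j => ?_
  have h1 : Continuous fun p : E × F =>
      fourierPowSMulRight (innerSL ℝ (E := E)) (fun _ => p.2) p.1 j := by
    have := (continuous_snd (X := E) (Y := F)).fourierPowSMulRight
      (((innerSL ℝ (E := E))).comp (ContinuousLinearMap.fst ℝ E F)) j
    exact this
  have h2 : Continuous fun q : (E × F) × Metric.closedBall (0 : E) k =>
      ((Real.fourierChar (-⟪q.1.1, (q.2 : E)⟫) : Circle) : ℂ) :=
    continuous_subtype_val.comp (Real.continuous_fourierChar.comp (by fun_prop))
  refine (h2.smul (h1.comp continuous_fst)).congr fun q => ?_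
  exact (jets_wave_apply k q.1.1 q.1.2 j q.2).symm

theorem norm_jets_wave_le (k : ℕ) (ξ : E) (v : F) :
    ‖SmoothFun.jets k (wave ξ v)‖ ≤
      (1 + 2 * Real.pi * ‖innerSL ℝ (E := E)‖) ^ k * (1 + ‖ξ‖) ^ k * ‖v‖ := by
  refine JetSpace.norm_le _ (by positivity) fun j x => ?_
  have hj : (j : ℕ) ≤ k := by omega
  have h0 : ∀ (c : Circle) (M : ContinuousMultilinearMap ℝ (fun _ : Fin (j : ℕ) => E) F),
      ‖c • M‖ = ‖M‖ := fun c M => by rw [Circle.smul_def, norm_smul, Circle.norm_coe, one_mul]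
  rw [jets_wave_apply]
  refine (h0 _ _).le.trans ?_
  refine (norm_fourierPowSMulRight_le (innerSL ℝ) (fun _ => v) ξ j).trans ?_
  gcongr
  · calc (2 * Real.pi * ‖innerSL ℝ (E := E)‖) ^ (j : ℕ)
        ≤ (1 + 2 * Real.pi * ‖innerSL ℝ (E := E)‖) ^ (j : ℕ) := by
          gcongr
          linarith
      _ ≤ _ := pow_le_pow_right₀ (le_add_of_nonneg_right (by positivity)) hj
  · calc ‖ξ‖ ^ (j : ℕ) ≤ (1 + ‖ξ‖) ^ (j : ℕ) := by
          gcongr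
          linarith
      _ ≤ _ := pow_le_pow_right₀ (le_add_of_nonneg_right (by positivity)) hj

/-- The Fourier transform of a function with integrable moments as a smooth function. -/
def fourierSmooth {h : E → F} (hh : HasMoments h) : SmoothFun E F := ⟨𝓕 h, hh.contDiff⟩

theorem HasMoments.integrable_one_add_norm_pow {h : E → F} (hh : HasMoments h) (k : ℕ) :
    Integrable fun ξ => (1 + ‖ξ‖) ^ k * ‖h ξ‖ := by
  have h1 : (fun ξ : E => (1 + ‖ξ‖) ^ k * ‖h ξ‖) = fun ξ =>
      ∑ m ∈ Finset.range (k + 1), (k.choose m : ℝ) * (‖ξ‖ ^ m * ‖h ξ‖) := by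
    funext ξ
    rw [add_comm, add_pow, Finset.sum_mul]
    refine Finset.sum_congr rfl fun m _ => ?_
    rw [one_pow]
    ring
  rw [h1]
  exact integrable_finsetSum _ fun m _ => (hh.2 m).const_mul _

theorem aestronglyMeasurable_comp_prodMk {X : Type*} [TopologicalSpace X] {h : E → F}
    (hh : AEStronglyMeasurable h) {f : E × F → X} (hf : Continuous f) :
    AEStronglyMeasurable fun ξ => f (ξ, h ξ) :=
  hf.comp_aestronglyMeasurable (continuous_id.aestronglyMeasurable.prodMk hh)

theorem aestronglyMeasurable_jets_wave {h : E → F} (hh : AEStronglyMeasurable h) (k : ℕ) :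
    AEStronglyMeasurable fun ξ => SmoothFun.jets k (wave ξ (h ξ)) := by
  have h1 := aestronglyMeasurable_comp_prodMk hh (continuous_jets_wave (E := E) (F := F) k)
  exact h1

theorem integrable_jets_wave {h : E → F} (hh : HasMoments h) (k : ℕ) :
    Integrable fun ξ => SmoothFun.jets k (wave ξ (h ξ)) := by
  refine ((hh.integrable_one_add_norm_pow k).const_mul
    ((1 + 2 * Real.pi * ‖innerSL ℝ (E := E)‖) ^ k)).mono' ?_ (ae_of_all _ fun ξ => ?_)
  · exact aestronglyMeasurable_jets_wave hh.1 k
  · exact (norm_jets_wave_le k ξ (h ξ)).trans (le_of_eq (by ring))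

/-- Evaluations of jets at points separate `JetSpace` and commute with the Bochner integral, so the
identity is the formula for derivatives of 𝓕 h. It lets a functional on jets pass under the
integral. -/
theorem jets_fourierSmooth {h : E → F} (hh : HasMoments h) (k : ℕ) :
    SmoothFun.jets k (fourierSmooth hh) = ∫ ξ, SmoothFun.jets k (wave ξ (h ξ)) := by
  have hi := integrable_jets_wave hh k
  refine JetSpace.ext fun j x => ?_
  have h1 : JetSpace.eval F k j x (∫ ξ, SmoothFun.jets k (wave ξ (h ξ))) =
      ∫ ξ, JetSpace.eval F k j x (SmoothFun.jets k (wave ξ (h ξ))) :=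
    ((JetSpace.eval F k j x).integral_comp_comm hi).symm
  refine Eq.trans ?_ h1.symm
  rw [SmoothFun.jets_apply]
  have h2 := congrFun (Real.iteratedFDeriv_fourier (f := h) (N := ⊤) (fun k _ => hh.2 k) hh.1
    (n := j) le_top) x
  refine h2.trans ?_
  rw [Real.fourier_eq]
  refine integral_congr_ae (ae_of_all _ fun ξ => ?_)
  exact (jets_wave_apply k ξ (h ξ) j x).symm

/-- A compactly supported distribution applied to a Fourier integral. -/
theorem clm_fourierSmooth (T : SmoothFun E F →L[ℂ] ℂ) {h : E → F} (hh : HasMoments h) :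
    T (fourierSmooth hh) = ∫ ξ, T (wave ξ (h ξ)) := by
  obtain ⟨k, T', hT'⟩ := SmoothFun.exists_factor_jets T
  simp only [hT']
  rw [jets_fourierSmooth, T'.integral_comp_comm (integrable_jets_wave hh k)]

theorem norm_clm_wave_le (T : SmoothFun E F →L[ℂ] ℂ) :
    ∃ (C : ℝ) (k : ℕ), 0 ≤ C ∧ ∀ (ξ : E) (v : F), ‖T (wave ξ v)‖ ≤ C * ((1 + ‖ξ‖) ^ k * ‖v‖) := by
  obtain ⟨k, T', hT'⟩ := SmoothFun.exists_factor_jets T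
  refine ⟨‖T'‖ * (1 + 2 * Real.pi * ‖innerSL ℝ (E := E)‖) ^ k, k, by positivity, fun ξ v => ?_⟩
  rw [hT', mul_assoc, ← mul_assoc (_ ^ k)]
  exact (T'.le_opNorm _).trans (by gcongr; exact norm_jets_wave_le k ξ v)

theorem aestronglyMeasurable_clm_wave (T : SmoothFun E F →L[ℂ] ℂ) {h : E → F}
    (hh : AEStronglyMeasurable h) : AEStronglyMeasurable fun ξ => T (wave ξ (h ξ)) := by
  obtain ⟨k, T', hT'⟩ := SmoothFun.exists_factor_jets T
  simp only [hT']
  exact T'.continuous.comp_aestronglyMeasurable (aestronglyMeasurable_jets_wave hh k)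

end Wave

end DiracComplex

namespace DiracComplex

/-! ### Cutoffs of smooth functions -/

open Filter Topology MeasureTheory
open scoped FourierTransform SchwartzMap RealInnerProductSpace

section Cutoff

variable {E F : Type*} [NormedAddCommGroup E] [NormedSpace ℝ E]
  [NormedAddCommGroup F] [NormedSpace ℂ F]

theorem SmoothFun.eventually_norm_jet_lt (k : ℕ) {K : Set E} (hK : IsCompact K) {δ : ℝ}
    (hδ : 0 < δ) : ∀ᶠ ψ in 𝓝 (0 : SmoothFun E F), ∀ x ∈ K, ‖SmoothFun.jet k ψ x‖ < δ := by
  have h := (SmoothFun.continuous_jet (E := E) (F := F) k).tendsto 0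
  rw [map_zero, ContinuousMap.tendsto_iff_forall_isCompact_tendstoUniformlyOn] at h
  filter_upwards [Metric.tendstoUniformlyOn_iff.1 (h K hK) δ hδ] with ψ hψ x hx
  simpa [dist_comm] using hψ x hx

variable {χ : E → ℝ}

/-- Multiplication of smooth functions by a compactly supported smooth function, as a linear map
to the Schwartz space. -/
def cutoffLM (hχ : ContDiff ℝ ∞ χ) (hc : HasCompactSupport χ) :
    SmoothFun E F →ₗ[ℂ] 𝓢(E, F) where
  toFun ψ := (HasCompactSupport.smul_right hc (f' := ψ)).toSchwartzMap (hχ.smul ψ.contDiff)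
  map_add' ψ₁ ψ₂ := SchwartzMap.ext fun x => smul_add (χ x) (ψ₁ x) (ψ₂ x)
  map_smul' c ψ := SchwartzMap.ext fun x => smul_comm (χ x) c (ψ x)

/-- By the Leibniz rule only the jets of ψ on the support of χ enter, and these are controlled by
the topology of ℰ. -/
theorem norm_pow_mul_iteratedFDeriv_cutoff_le (hχ : ContDiff ℝ ∞ χ) (hc : HasCompactSupport χ)
    (ψ : SmoothFun E F) (k l : ℕ) {δ : ℝ} (hδ : 0 ≤ δ)
    (h : ∀ j ≤ l, ∀ x ∈ tsupport χ, ‖SmoothFun.jet j ψ x‖ ≤ δ) (x : E) :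
    ‖x‖ ^ k * ‖iteratedFDeriv ℝ l (cutoffLM hχ hc ψ) x‖ ≤
      (∑ i ∈ Finset.range (l + 1), (l.choose i : ℝ) *
        SchwartzMap.seminorm ℝ k i (hc.toSchwartzMap hχ)) * δ := by
  have h1 := norm_iteratedFDeriv_smul_le hχ ψ.contDiff x (n := l) (by exact_mod_cast le_top)
  calc ‖x‖ ^ k * ‖iteratedFDeriv ℝ l (cutoffLM hχ hc ψ) x‖
      ≤ ‖x‖ ^ k * ∑ i ∈ Finset.range (l + 1), (l.choose i : ℝ) * ‖iteratedFDeriv ℝ i χ x‖ *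
          ‖iteratedFDeriv ℝ (l - i) ψ x‖ := by
        gcongr
        exact h1
    _ = ∑ i ∈ Finset.range (l + 1), (l.choose i : ℝ) * ((‖x‖ ^ k * ‖iteratedFDeriv ℝ i χ x‖) *
          ‖iteratedFDeriv ℝ (l - i) ψ x‖) := by
        rw [Finset.mul_sum]
        exact Finset.sum_congr rfl fun i _ => by ring
    _ ≤ ∑ i ∈ Finset.range (l + 1), (l.choose i : ℝ) *
          (SchwartzMap.seminorm ℝ k i (hc.toSchwartzMap hχ) * δ) := by
        refine Finset.sum_le_sum fun i _ => mul_le_mul_of_nonneg_left ?_ (by positivity)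
        by_cases hx : x ∈ tsupport χ
        · gcongr
          · exact SchwartzMap.le_seminorm ℝ k i (hc.toSchwartzMap hχ) x
          · exact h _ (Nat.sub_le _ _) x hx
        · have h0 : iteratedFDeriv ℝ i χ x = 0 := by
            by_contra hne
            exact hx (support_iteratedFDeriv_subset i hne)
          rw [h0]
          simp only [norm_zero, mul_zero, zero_mul]
          positivity
    _ = _ := by
        rw [Finset.sum_mul]
        exact Finset.sum_congr rfl fun i _ => by ring

/-- Multiplication of smooth functions by a compactly supported smooth function, as a continuous
linear map to the Schwartz space. -/
def cutoffCLM (hχ : ContDiff ℝ ∞ χ) (hc : HasCompactSupport χ) :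
    SmoothFun E F →L[ℂ] 𝓢(E, F) where
  toLinearMap := cutoffLM hχ hc
  cont := by
    refine continuous_of_continuousAt_zero (cutoffLM hχ hc) ?_
    rw [ContinuousAt, map_zero, (schwartz_withSeminorms ℂ E F).tendsto_nhds]
    rintro ⟨k, l⟩ ε hε
    set C := ∑ i ∈ Finset.range (l + 1), (l.choose i : ℝ) *
        SchwartzMap.seminorm ℝ k i (hc.toSchwartzMap hχ) with hC
    have hC0 : 0 ≤ C := Finset.sum_nonneg fun i _ => by positivity
    have hev : ∀ᶠ ψ in 𝓝 (0 : SmoothFun E F), ∀ j ∈ Finset.range (l + 1), ∀ x ∈ tsupport χ,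
        ‖SmoothFun.jet j ψ x‖ < ε / (C + 1) :=
      (Finset.eventually_all _).2 fun j _ =>
        SmoothFun.eventually_norm_jet_lt j hc (by positivity)
    filter_upwards [hev] with ψ hψ
    rw [sub_zero]
    refine (SchwartzMap.seminorm_le_bound ℂ k l (cutoffLM hχ hc ψ) (by positivity)
      (norm_pow_mul_iteratedFDeriv_cutoff_le hχ hc ψ k l (by positivity)
        fun j hj x hx => (hψ j (Finset.mem_range.2 (by omega)) x hx).le)).trans_lt ?_
    rw [← hC, mul_div_assoc', div_lt_iff₀ (by positivity)]
    nlinarith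

theorem cutoffCLM_apply (hχ : ContDiff ℝ ∞ χ) (hc : HasCompactSupport χ) (ψ : SmoothFun E F)
    (x : E) : cutoffCLM hχ hc ψ x = χ x • ψ x := rfl

end Cutoff

/-! ### The parametrix -/

section Parametrix

variable {n : ℕ} {V W : Type*} [NormedAddCommGroup V] [NormedSpace ℂ V] [CompleteSpace V]
  [NormedAddCommGroup W] [NormedSpace ℂ W] [CompleteSpace W]
  (a : Fin 2 × Fin n → V →L[ℂ] W)

/-- The inverse of the symbol of an operator whose adjoint has the coefficients `a`. -/
def inverseMultiplier (ξ : Dom n) : V →L[ℂ] W :=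
  (-(2 * Real.pi * Complex.I))⁻¹ • homogMultiplier a ξ

theorem neg_two_pi_I_ne_zero : (-(2 * Real.pi * Complex.I)) ≠ 0 := by simp [Real.pi_ne_zero]

theorem hasMoments_inverseMultiplier (hn : 0 < n) (g : 𝓢(Dom n, V)) :
    HasMoments fun ξ => inverseMultiplier a ξ (g ξ) :=
  (hasMoments_homogMultiplier a hn g).clm_comp
    ((-(2 * Real.pi * Complex.I))⁻¹ • ContinuousLinearMap.id ℂ W)

/-- The operator with coefficients `b` inverts the parametrix. -/
theorem sum_fderiv_parametrix (hn : 0 < n) {b : Fin 2 × Fin n → W →L[ℂ] V}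
    (hab : ∀ i k u, b i (a k u) + b k (a i u) = if i = k then (2 : ℂ) • u else 0)
    (θ : 𝓢(Dom n, V)) (x : Dom n) :
    ∑ i, b i (fderiv ℝ (𝓕 fun ξ => inverseMultiplier a ξ (𝓕⁻ θ ξ)) x (coordVec n i)) = θ x := by
  rw [(hasMoments_inverseMultiplier a hn (𝓕⁻ θ)).sum_fderiv_fourier]
  have h1 : (fun ξ => (-(2 * Real.pi * Complex.I)) • symbol b ξ
      (inverseMultiplier a ξ (𝓕⁻ θ ξ))) =ᵐ[volume] (𝓕⁻ θ : 𝓢(Dom n, V)) := by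
    filter_upwards [ae_ne_zero hn] with ξ hξ
    have hξ' : ((‖ξ‖ : ℂ)) ^ 2 ≠ 0 := by simpa using hξ
    simp only [inverseMultiplier, homogMultiplier, smul_apply, map_smul,
      symbol_comp_of_clifford hab, smul_smul]
    rw [inv_mul_cancel_right₀ hξ', mul_inv_cancel₀ neg_two_pi_I_ne_zero, one_smul]
  calc 𝓕 (fun ξ => (-(2 * Real.pi * Complex.I)) • symbol b ξ
        (inverseMultiplier a ξ (𝓕⁻ θ ξ))) x
      = 𝓕 ((𝓕⁻ θ : 𝓢(Dom n, V)) : Dom n → V) x := by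
        rw [Real.fourier_eq, Real.fourier_eq]
        refine integral_congr_ae (h1.mono fun ξ hξ => ?_)
        simp only at hξ ⊢
        rw [hξ]
    _ = θ x := by rw [← SchwartzMap.fourier_coe, FourierTransform.fourier_fourierInv_eq]

variable (T : SmoothFun (Dom n) W →L[ℂ] ℂ)

/-- The Fourier transform of the composition of a compactly supported distribution with the
parametrix, paired with a Schwartz function. -/
def parametrixDensity (g : 𝓢(Dom n, V)) (ξ : Dom n) : ℂ := T (wave ξ (inverseMultiplier a ξ (g ξ)))

/-- C and k do not depend on g; this uniformity gives the continuity of `parametrixFunctional`. -/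
theorem norm_parametrixDensity_le : ∃ (C : ℝ) (k : ℕ), 0 ≤ C ∧ ∀ (g : 𝓢(Dom n, V)) (ξ : Dom n),
    ‖parametrixDensity a T g ξ‖ ≤ C * (‖ξ‖⁻¹ * (1 + ‖ξ‖) ^ k * ‖g ξ‖) := by
  obtain ⟨C, k, hC, hT⟩ := norm_clm_wave_le T
  refine ⟨C * (‖(-(2 * Real.pi * Complex.I))⁻¹‖ * ∑ i, ‖a i‖), k, by positivity, fun g ξ => ?_⟩
  refine (hT ξ _).trans ?_
  have h1 : ‖inverseMultiplier a ξ (g ξ)‖ ≤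
      ‖(-(2 * Real.pi * Complex.I))⁻¹‖ * ((∑ i, ‖a i‖) * ‖ξ‖⁻¹) * ‖g ξ‖ := by
    refine (ContinuousLinearMap.le_opNorm _ _).trans ?_
    rw [inverseMultiplier, norm_smul]
    gcongr
    exact norm_homogMultiplier_le a ξ
  calc C * ((1 + ‖ξ‖) ^ k * ‖inverseMultiplier a ξ (g ξ)‖) ≤ C * ((1 + ‖ξ‖) ^ k *
        (‖(-(2 * Real.pi * Complex.I))⁻¹‖ * ((∑ i, ‖a i‖) * ‖ξ‖⁻¹) * ‖g ξ‖)) := by gcongr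
    _ = _ := by ring

theorem hasMoments_parametrixDensity (hn : 0 < n) (g : 𝓢(Dom n, V)) :
    HasMoments (parametrixDensity a T g) := by
  obtain ⟨C, k, -, h⟩ := norm_parametrixDensity_le a T
  exact hasMoments_of_le_schwartz (by rw [finrank_dom]; omega)
    (aestronglyMeasurable_clm_wave T (hasMoments_inverseMultiplier a hn g).1) g C k (h g)

theorem wave_add (ξ : Dom n) (v w : W) : wave ξ (v + w) = wave ξ v + wave ξ w :=
  SmoothFun.ext fun x => smul_add (Real.fourierChar (-⟪ξ, x⟫)) v w

theorem parametrixDensity_add (g g' : 𝓢(Dom n, V)) (ξ : Dom n) :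
    parametrixDensity a T (g + g') ξ = parametrixDensity a T g ξ + parametrixDensity a T g' ξ := by
  simp only [parametrixDensity, add_apply, map_add, wave_add]

/-- The hypothesis concerns a single ξ, so c may vary with ξ: the lemma covers the character of a
translation and the factor of a derivative. -/
theorem parametrixDensity_of_eq_smul {g g' : 𝓢(Dom n, V)} {c : ℂ} {ξ : Dom n}
    (h : g ξ = c • g' ξ) : parametrixDensity a T g ξ = c * parametrixDensity a T g' ξ := by
  simp only [parametrixDensity, h, map_smul, wave_smul, smul_eq_mul]

/-- The functional `g ↦ ∫ T(wave ξ (m(ξ) g(ξ))) dξ` on the Schwartz space. -/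
def parametrixFunctional (hn : 0 < n) : 𝓢(Dom n, V) →L[ℂ] ℂ :=
  SchwartzMap.mkCLMtoNormedSpace (fun g => ∫ ξ, parametrixDensity a T g ξ)
    (fun g g' => by
      simp only [parametrixDensity_add]
      exact integral_add (hasMoments_parametrixDensity a T hn g).integrable
        (hasMoments_parametrixDensity a T hn g').integrable)
    (fun c g => by
      have h : ∀ ξ, parametrixDensity a T (c • g) ξ = c * parametrixDensity a T g ξ := fun ξ =>
        parametrixDensity_of_eq_smul a T (by simp)
      simp only [h, integral_const_mul, RingHom.id_apply, smul_eq_mul])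
    (by
      obtain ⟨C, k, hC, h⟩ := norm_parametrixDensity_le a T
      set M := Module.finrank ℝ (Dom n) with hM
      have hE : 2 ≤ Module.finrank ℝ (Dom n) := by rw [finrank_dom]; omega
      refine ⟨Finset.Iic (k + M, 0), C * (2 ^ (k + M) *
        ∫ ξ : Dom n, ‖ξ‖⁻¹ * ((1 + ‖ξ‖) ^ M)⁻¹), ?_, fun g => ?_⟩
      · have : 0 ≤ ∫ ξ : Dom n, ‖ξ‖⁻¹ * ((1 + ‖ξ‖) ^ M)⁻¹ :=
          integral_nonneg fun ξ => by positivity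
        positivity
      · refine (norm_integral_le_of_norm_le (((integrable_inv_norm_mul_one_add_norm_pow
          hE).const_mul (2 ^ (k + M) * (Finset.Iic (k + M, 0)).sup
            (schwartzSeminormFamily ℂ (Dom n) V) g)).const_mul C) (ae_of_all _ fun ξ =>
          (h g ξ).trans (mul_le_mul_of_nonneg_left (norm_mul_schwartz_le g k M ξ) hC))).trans
            (le_of_eq ?_)
        rw [integral_const_mul, integral_const_mul]
        ring)

/-- The composition of a compactly supported distribution with the parametrix, as a tempered
distribution. -/
def parametrixDistr (hn : 0 < n) : 𝓢(Dom n, V) →L[ℂ] ℂ :=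
  (parametrixFunctional a T hn).comp (FourierTransform.fourierInvCLM ℂ 𝓢(Dom n, V))

theorem parametrixDistr_eq_integral (hn : 0 < n) (θ : 𝓢(Dom n, V)) :
    parametrixDistr a T hn θ = ∫ ξ, parametrixDensity a T (𝓕⁻ θ) ξ := rfl

theorem parametrixDistr_eq (hn : 0 < n) (θ : 𝓢(Dom n, V)) :
    parametrixDistr a T hn θ = T (fourierSmooth (hasMoments_inverseMultiplier a hn (𝓕⁻ θ))) := by
  rw [parametrixDistr_eq_integral, clm_fourierSmooth]
  rfl

/-- A Schwartz function as a smooth function. -/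
def schwartzToSmooth (φ : 𝓢(Dom n, W)) : SmoothFun (Dom n) W := ⟨φ, φ.smooth ⊤⟩

/-- The parametrix is only a right inverse: applied to `schwartzOp b φ` it returns φ up to an
element of the kernel, which T annihilates. This element need not be Schwartz, so `hT` ranges over
all smooth functions. -/
theorem parametrixDistr_schwartzOp (hn : 0 < n) {b : Fin 2 × Fin n → W →L[ℂ] V}
    (hab : ∀ i k u, b i (a k u) + b k (a i u) = if i = k then (2 : ℂ) • u else 0)
    (hT : ∀ ψ : SmoothFun (Dom n) W, (∀ x, ∑ i, b i (fderiv ℝ ψ x (coordVec n i)) = 0) → T ψ = 0)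
    (φ : 𝓢(Dom n, W)) : parametrixDistr a T hn (schwartzOp b φ) = T (schwartzToSmooth φ) := by
  rw [parametrixDistr_eq, ← sub_eq_zero, ← map_sub]
  refine hT _ fun x => ?_
  set hm := hasMoments_inverseMultiplier a hn (𝓕⁻ (schwartzOp b φ)) with hhm
  have h1 : fderiv ℝ (fourierSmooth hm - schwartzToSmooth φ : SmoothFun (Dom n) W) x =
      fderiv ℝ (fourierSmooth hm) x - fderiv ℝ φ x :=
    fderiv_sub ((fourierSmooth hm).contDiff.differentiable (by simp) x) φ.differentiableAt
  simp only [h1, sub_apply, map_sub, Finset.sum_sub_distrib]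
  rw [← schwartzOp_apply, sub_eq_zero]
  exact sum_fderiv_parametrix a hn hab (schwartzOp b φ) x

end Parametrix

end DiracComplex

namespace DiracComplex

open Filter Topology MeasureTheory LineDeriv
open scoped FourierTransform SchwartzMap RealInnerProductSpace

/-! ### Translations -/

section Translate

variable {n : ℕ} {V W : Type*} [NormedAddCommGroup V] [NormedSpace ℂ V]
  [NormedAddCommGroup W] [NormedSpace ℂ W]

/-- The translate `x ↦ θ (x + y)`. -/
def translate (y : Dom n) (θ : 𝓢(Dom n, V)) : 𝓢(Dom n, V) := SchwartzMap.compSubConstCLM ℂ (-y) θ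

theorem translate_apply (y : Dom n) (θ : 𝓢(Dom n, V)) (x : Dom n) :
    translate y θ x = θ (x + y) := by
  simp [translate]

theorem schwartzOp_translate (b : Fin 2 × Fin n → V →L[ℂ] W) (y : Dom n) (φ : 𝓢(Dom n, V)) :
    schwartzOp b (translate y φ) = translate y (schwartzOp b φ) := by
  ext1 x
  rw [translate_apply, schwartzOp_apply, schwartzOp_apply]
  have h : (translate y φ : Dom n → V) = fun x => φ (x + y) := funext (translate_apply y φ)
  rw [h]
  simp only [fderiv_comp_add_right]

variable [CompleteSpace V] [CompleteSpace W] (a : Fin 2 × Fin n → V →L[ℂ] W)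
  (T : SmoothFun (Dom n) W →L[ℂ] ℂ)

theorem fourierInv_translate (y : Dom n) (θ : 𝓢(Dom n, V)) (ξ : Dom n) :
    𝓕⁻ (translate y θ) ξ = ((Real.fourierChar (-⟪ξ, y⟫) : Circle) : ℂ) • 𝓕⁻ θ ξ := by
  rw [SchwartzMap.fourierInv_coe, SchwartzMap.fourierInv_coe, Real.fourierInv_eq,
    Real.fourierInv_eq, ← integral_smul]
  rw [← integral_add_right_eq_self (fun v => ((Real.fourierChar (-⟪ξ, y⟫) : Circle) : ℂ) •
    (Real.fourierChar ⟪v, ξ⟫ • θ v)) y]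
  refine integral_congr_ae (ae_of_all _ fun v => ?_)
  have h : ⟪v, ξ⟫ = -⟪ξ, y⟫ + ⟪v + y, ξ⟫ := by
    rw [inner_add_left, real_inner_comm ξ y]
    ring
  simp only [translate_apply]
  rw [h, AddChar.map_add_eq_mul, mul_smul]
  rfl

/-- Translation multiplies 𝓕⁻θ by a character. As a function of y the value is thus the Fourier
transform of a function with integrable moments: smooth and vanishing at infinity. -/
theorem parametrixDistr_translate (hn : 0 < n) (θ : 𝓢(Dom n, V)) (y : Dom n) :
    parametrixDistr a T hn (translate y θ) = 𝓕 (parametrixDensity a T (𝓕⁻ θ)) y := by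
  rw [parametrixDistr_eq_integral, Real.fourier_eq]
  refine integral_congr_ae (ae_of_all _ fun ξ => ?_)
  exact parametrixDensity_of_eq_smul a T (fourierInv_translate y θ ξ)

theorem contDiff_parametrixDistr_translate (hn : 0 < n) (θ : 𝓢(Dom n, V)) :
    ContDiff ℝ ∞ fun y => parametrixDistr a T hn (translate y θ) := by
  simp only [parametrixDistr_translate]
  exact (hasMoments_parametrixDensity a T hn (𝓕⁻ θ)).contDiff

theorem tendsto_parametrixDistr_translate (hn : 0 < n) (θ : 𝓢(Dom n, V)) :
    Tendsto (fun y => parametrixDistr a T hn (translate y θ)) (cocompact (Dom n)) (𝓝 0) := by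
  simp only [parametrixDistr_translate]
  exact HasMoments.tendsto_fourier _

theorem fderiv_parametrixDistr_translate (hn : 0 < n) (θ : 𝓢(Dom n, V)) (y e : Dom n) :
    fderiv ℝ (fun y => parametrixDistr a T hn (translate y θ)) y e =
      parametrixDistr a T hn (translate y (∂_{e} θ)) := by
  simp only [parametrixDistr_translate]
  refine ((hasMoments_parametrixDensity a T hn (𝓕⁻ θ)).fderiv_fourier_apply y e).trans ?_
  refine congrArg (fun u : Dom n → ℂ => 𝓕 u y) (funext fun ξ => ?_)
  rw [smul_eq_mul]
  refine (parametrixDensity_of_eq_smul a T ?_).symm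
  have : (inner ℝ · e : Dom n → ℝ).HasTemperateGrowth := by fun_prop
  rw [SchwartzMap.fourierInv_lineDerivOp_eq, smul_apply,
    SchwartzMap.smulLeftCLM_apply_apply this, mul_smul, Complex.coe_smul]

end Translate

/-! ### The range on compactly supported distributions -/

section Distr

variable {n : ℕ}

/-- The minus sign of the formal transpose is put on both families and cancels in the products. -/
theorem neg_diracCoeffTranspose_clifford (i k : Fin 2 × Fin n) (u : V0 n) :
    (-diracCoeffTranspose n i) ((-diracAdjCoeffTranspose n k) u) +
      (-diracCoeffTranspose n k) ((-diracAdjCoeffTranspose n i) u) =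
      if i = k then (2 : ℂ) • u else 0 := by
  simp only [neg_apply, map_neg, neg_neg]
  exact diracCoeffTranspose_clifford n i k u

theorem diracTranspose_eq_sum (φ : SmoothSpace n (V1 n)) (x : Dom n) :
    diracTranspose n φ x = ∑ i, (-diracCoeffTranspose n i) (fderiv ℝ φ x (coordVec n i)) := by
  rw [diracTranspose_apply, ← Finset.sum_neg_distrib]
  rfl

theorem lineDeriv_eq_zero_of_eqOn {V : Type*} [NormedAddCommGroup V] [NormedSpace ℂ V]
    {θ : 𝓢(Dom n, V)} {U : Set (Dom n)} (hU : IsOpen U) (hθ : ∀ x ∈ U, θ x = 0) (e : Dom n) :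
    ∀ x ∈ U, (∂_{e} θ) x = 0 := by
  intro x hx
  have he : (θ : Dom n → V) =ᶠ[𝓝 x] fun _ => 0 := by
    filter_upwards [hU.mem_nhds hx] with y hy using hθ y hy
  rw [SchwartzMap.lineDerivOp_apply_eq_fderiv, he.fderiv_eq]
  simp

theorem lineDerivOp_postcompCLM {V W : Type*} [NormedAddCommGroup V] [NormedSpace ℂ V]
    [NormedAddCommGroup W] [NormedSpace ℂ W] (L : V →L[ℂ] W) (e : Dom n) (θ : 𝓢(Dom n, V)) :
    ∂_{e} (SchwartzMap.postcompCLM L θ) = SchwartzMap.postcompCLM L (∂_{e} θ) := by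
  ext1 x
  rw [SchwartzMap.postcompCLM_apply, SchwartzMap.lineDerivOp_apply_eq_fderiv,
    SchwartzMap.lineDerivOp_apply_eq_fderiv]
  exact congrArg (fun u => u e)
    ((L.restrictScalars ℝ).hasFDerivAt.comp x θ.differentiableAt.hasFDerivAt).fderiv

theorem lineDerivOp_lineDerivOp_apply_comm {V : Type*} [NormedAddCommGroup V] [NormedSpace ℂ V]
    (θ : 𝓢(Dom n, V)) (v w x : Dom n) : (∂_{v} (∂_{w} θ)) x = (∂_{w} (∂_{v} θ)) x := by
  have hθ : ContDiff ℝ 2 θ := θ.smooth 2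
  exact fderiv_fderiv_comm hθ x w v

theorem schwartzOp_sum_postcompCLM_apply {ι V W : Type*} [Fintype ι] [NormedAddCommGroup V]
    [NormedSpace ℂ V] [NormedAddCommGroup W] [NormedSpace ℂ W] (b : Fin 2 × Fin n → W →L[ℂ] V)
    (a : ι → V →L[ℂ] W) (e : ι → Dom n) (θ : 𝓢(Dom n, V)) (x : Dom n) :
    schwartzOp b (∑ k, SchwartzMap.postcompCLM (a k) (∂_{e k} θ)) x =
      ∑ i, ∑ k, b i (a k ((∂_{coordVec n i} (∂_{e k} θ)) x)) := by
  rw [schwartzOp_apply]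
  refine Finset.sum_congr rfl fun i _ => ?_
  rw [← SchwartzMap.lineDerivOp_apply_eq_fderiv, lineDerivOp_sum, sum_apply, map_sum]
  refine Finset.sum_congr rfl fun k _ => ?_
  rw [lineDerivOp_postcompCLM, SchwartzMap.postcompCLM_apply]

/-- By `h0` only the derivatives in x_A survive; `sum_clifford` then applies to the symmetric second
derivatives. -/
theorem schwartzOp_sum_postcompCLM_of_clifford {V W : Type*} [NormedAddCommGroup V]
    [NormedSpace ℂ V] [NormedAddCommGroup W] [NormedSpace ℂ W] {b : Fin 2 × Fin n → W →L[ℂ] V}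
    {a : Fin 2 × Fin n → V →L[ℂ] W}
    (hab : ∀ i k u, b i (a k u) + b k (a i u) = if i = k then (2 : ℂ) • u else 0) {A : Fin 2}
    (h0 : ∀ B, B ≠ A → ∀ j k u, b (B, j) (a (A, k) u) = 0) (θ : 𝓢(Dom n, V)) :
    schwartzOp b (∑ k, SchwartzMap.postcompCLM (a (A, k)) (∂_{coordVec n (A, k)} θ)) =
      ∑ j, ∂_{coordVec n (A, j)} (∂_{coordVec n (A, j)} θ) := by
  ext1 x
  have h1 := sum_clifford (C := fun j k u => b (A, j) (a (A, k) u))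
    (fun j k u => by simpa using hab (A, j) (A, k) u)
    (b := fun j k => (∂_{coordVec n (A, j)} (∂_{coordVec n (A, k)} θ)) x)
    fun j k => lineDerivOp_lineDerivOp_apply_comm θ _ _ x
  rw [schwartzOp_sum_postcompCLM_apply, Fintype.sum_prod_type, Finset.sum_eq_single A
    (fun B _ hB => Finset.sum_eq_zero fun j _ => Finset.sum_eq_zero fun k _ => h0 B hB j k _)
    (by simp), sum_apply]
  exact h1

/-- The Laplacian in the variables `x_{Aj}` factors through the transpose of `𝒟₀`. -/
theorem exists_schwartzOp_eq_laplacian (A : Fin 2) (θ : 𝓢(Dom n, V0 n)) :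
    ∃ φ : 𝓢(Dom n, V1 n),
      schwartzOp (fun i => -diracCoeffTranspose n i) φ =
        ∑ j, ∂_{coordVec n (A, j)} (∂_{coordVec n (A, j)} θ) ∧
      ∀ U : Set (Dom n), IsOpen U → (∀ x ∈ U, θ x = 0) → ∀ x ∈ U, φ x = 0 := by
  refine ⟨∑ k, SchwartzMap.postcompCLM (-diracAdjCoeffTranspose n (A, k))
    (∂_{coordVec n (A, k)} θ), schwartzOp_sum_postcompCLM_of_clifford
      (a := fun i => -diracAdjCoeffTranspose n i) neg_diracCoeffTranspose_clifford ?_ θ, ?_⟩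
  · intro B hB j k u
    simp [diracCoeffTranspose, diracAdjCoeffTranspose, Pi.single_eq_of_ne hB]
  · intro U hU hθ x hx
    rw [sum_apply]
    refine Finset.sum_eq_zero fun k _ => ?_
    rw [SchwartzMap.postcompCLM_apply, lineDeriv_eq_zero_of_eqOn hU hθ _ x hx, map_zero]

/-- The set of the points with `|x_B|² < r`. -/
def slab (n : ℕ) (B : Fin 2) (r : ℝ) : Set (Dom n) := {x | ∑ j, x (B, j) ^ 2 < r}

theorem isOpen_slab (B : Fin 2) (r : ℝ) : IsOpen (slab n B r) :=
  isOpen_lt (by fun_prop) continuous_const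

theorem closedBall_subset_slab (B : Fin 2) {R r : ℝ} (h : R ^ 2 < r) :
    Metric.closedBall 0 R ⊆ slab n B r := by
  intro x hx
  rw [mem_closedBall_zero_iff] at hx
  exact ((sum_sq_coord_le x B).trans (by gcongr)).trans_lt h

variable {T : CompactDistr n (V1 n)}

/-- The parametrix of a distribution that annihilates the kernel of the transpose vanishes outside
of a compact set. -/
theorem parametrixDistr_eq_zero (hn : 0 < n)
    (hT : ∀ ψ : SmoothSpace n (V1 n), diracTranspose n ψ = 0 → T ψ = 0) {R r : ℝ}
    (hR : ∀ (φ : SmoothSpace n (V1 n)) (U : Set (Dom n)), IsOpen U → Metric.closedBall 0 R ⊆ U →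
      (∀ x ∈ U, φ x = 0) → T φ = 0) (hr : R ^ 2 < r) {A B : Fin 2} (hAB : A ≠ B)
    (θ : 𝓢(Dom n, V0 n)) (hθ : ∀ x ∈ slab n B r, θ x = 0) :
    parametrixDistr (fun i => -diracAdjCoeffTranspose n i) T hn θ = 0 := by
  have : Nonempty (Fin n) := ⟨⟨0, hn⟩⟩
  set S := parametrixDistr (fun i => -diracAdjCoeffTranspose n i) T hn with hS
  have hST : ∀ φ : 𝓢(Dom n, V1 n),
      S (schwartzOp (fun i => -diracCoeffTranspose n i) φ) = T (schwartzToSmooth φ) :=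
    parametrixDistr_schwartzOp _ T hn neg_diracCoeffTranspose_clifford fun ψ hψ =>
      hT ψ (SmoothFun.ext fun x => (diracTranspose_eq_sum ψ x).trans (hψ x))
  obtain ⟨φ, hφ, hφ0⟩ := exists_schwartzOp_eq_laplacian A θ
  -- Liouville for y ↦ S(translate y θ) on the subspace y_B = 0, whose translations preserve the
  -- slab; the value at y = 0 is S θ.
  have h0 := eq_zero_of_harmonic_of_tendsto_zero (e := fun j => coordVec n (A, j))
    (fun j => coordVec_ne_zero _) (A := {y : Dom n | ∀ k, y (B, k) = 0})
    (f := fun y => S (translate y θ)) ?_ ?_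
    ((contDiff_parametrixDistr_translate _ T hn θ).of_le (by norm_cast))
    (tendsto_parametrixDistr_translate _ T hn θ) ?_ 0 (fun k => rfl)
  · have h1 : translate 0 θ = θ := by
      ext1 x
      rw [translate_apply, add_zero]
    rwa [h1] at h0
  · simp only [Set.ofPred_forall]
    exact isClosed_iInter fun k => isClosed_eq (by fun_prop) continuous_const
  · intro y hy i t k
    have hy : ∀ k, y (B, k) = 0 := hy
    simp [coordVec_apply_of_ne hAB, hy k]
  · intro y hy
    have hy : ∀ k, y (B, k) = 0 := hy
    simp only [hS, fderiv_parametrixDistr_translate]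
    rw [← hS, ← map_sum]
    have h1 : ∑ j, translate y (∂_{coordVec n (A, j)} (∂_{coordVec n (A, j)} θ)) =
        schwartzOp (fun i => -diracCoeffTranspose n i) (translate y φ) := by
      rw [schwartzOp_translate, hφ]
      simp only [translate, map_sum]
    rw [h1, hST]
    -- The Laplacian in y is T of the translated φ, which vanishes on the slab, an open
    -- neighbourhood of the ball that carries T.
    refine hR _ (slab n B r) (isOpen_slab B r) (closedBall_subset_slab B hr) fun x hx => ?_
    refine (translate_apply y φ x).trans (hφ0 _ (isOpen_slab B r) hθ _ ?_)
    simpa [slab, hy] using hx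

end Distr

end DiracComplex

namespace DiracComplex

open Filter Topology MeasureTheory
open scoped FourierTransform SchwartzMap RealInnerProductSpace

/-! ### Closedness of the range on compactly supported distributions -/

section DistrRange

variable {n : ℕ}

/-- A smooth function that equals `1` where `|x_B|² ≤ r` and vanishes where `r + 1 ≤ |x_B|²`. -/
def slabCutoff (n : ℕ) (B : Fin 2) (r : ℝ) (x : Dom n) : ℝ :=
  Real.smoothTransition (r + 1 - ∑ j, x (B, j) ^ 2)

theorem contDiff_slabCutoff (B : Fin 2) (r : ℝ) : ContDiff ℝ ∞ (slabCutoff n B r) :=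
  Real.smoothTransition.contDiff.comp (by fun_prop)

theorem slabCutoff_eq_one {B : Fin 2} {r : ℝ} {x : Dom n} (hx : x ∈ slab n B r) :
    slabCutoff n B r x = 1 := by
  have hx : ∑ j, x (B, j) ^ 2 < r := hx
  exact Real.smoothTransition.one_of_one_le (by linarith)

theorem sum_sq_lt_of_slabCutoff_ne_zero {B : Fin 2} {r : ℝ} {x : Dom n}
    (hx : slabCutoff n B r x ≠ 0) : ∑ j, x (B, j) ^ 2 < r + 1 := by
  by_contra! h
  exact hx (Real.smoothTransition.zero_of_nonpos (by linarith))

/-- A smooth function that equals `1` where `|x|² ≤ r` and vanishes where `r + 1 ≤ |x|²`. -/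
def ballCutoff (n : ℕ) (r : ℝ) (x : Dom n) : ℝ := Real.smoothTransition (r + 1 - ‖x‖ ^ 2)

theorem contDiff_ballCutoff (r : ℝ) : ContDiff ℝ ∞ (ballCutoff n r) :=
  Real.smoothTransition.contDiff.comp (contDiff_const.sub (contDiff_norm_sq ℝ))

theorem ballCutoff_eq_one {r : ℝ} {x : Dom n} (hx : ‖x‖ ^ 2 < r) : ballCutoff n r x = 1 :=
  Real.smoothTransition.one_of_one_le (by linarith)

theorem hasCompactSupport_of_norm_sq_lt {X : Type*} [Zero X] {f : Dom n → X} {r : ℝ}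
    (h : ∀ x, f x ≠ 0 → ‖x‖ ^ 2 < r) : HasCompactSupport f := by
  refine HasCompactSupport.intro (isCompact_closedBall (0 : Dom n) (Real.sqrt r)) fun x hx => ?_
  by_contra hne
  refine hx (mem_closedBall_zero_iff.2 (Real.le_sqrt_of_sq_le (h x hne).le))

theorem hasCompactSupport_ballCutoff (r : ℝ) : HasCompactSupport (ballCutoff n r) := by
  refine hasCompactSupport_of_norm_sq_lt (r := r + 1) fun x hx => ?_
  by_contra! h
  exact hx (Real.smoothTransition.zero_of_nonpos (by linarith))

theorem norm_sq_lt_of_slabCutoff_mul_ne_zero {r : ℝ} {x : Dom n}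
    (hx : slabCutoff n 0 r x * slabCutoff n 1 r x ≠ 0) : ‖x‖ ^ 2 < 2 * r + 2 := by
  have h0 := sum_sq_lt_of_slabCutoff_ne_zero (left_ne_zero_of_mul hx)
  have h1 := sum_sq_lt_of_slabCutoff_ne_zero (right_ne_zero_of_mul hx)
  rw [EuclideanSpace.norm_sq_eq, Fintype.sum_prod_type, Fin.sum_univ_two]
  simp only [Real.norm_eq_abs, sq_abs]
  linarith

theorem hasCompactSupport_slabCutoff_mul (n : ℕ) (r : ℝ) :
    HasCompactSupport fun x => slabCutoff n 0 r x * slabCutoff n 1 r x :=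
  hasCompactSupport_of_norm_sq_lt fun _ hx => norm_sq_lt_of_slabCutoff_mul_ne_zero hx

theorem hasCompactSupport_schwartzOp {V W : Type*} [NormedAddCommGroup V] [NormedSpace ℂ V]
    [NormedAddCommGroup W] [NormedSpace ℂ W] (c : Fin 2 × Fin n → V →L[ℂ] W) {φ : 𝓢(Dom n, V)}
    (hφ : HasCompactSupport φ) : HasCompactSupport (schwartzOp c φ) := by
  refine HasCompactSupport.intro hφ fun x hx => ?_
  have h : fderiv ℝ φ x = 0 := by
    by_contra hne
    exact hx (support_fderiv_subset ℝ hne)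
  simp [schwartzOp_apply, h]

variable {T : CompactDistr n (V1 n)}

/-- The tempered S solves the equation and vanishes on functions that are zero on either slab.
Multiplying it by the product of the slab cutoffs therefore loses nothing and extends it to ℰ. -/
theorem mem_range_diracDistr (hn : 0 < n)
    (hT : ∀ ψ : SmoothSpace n (V1 n), diracTranspose n ψ = 0 → T ψ = 0) :
    T ∈ Set.range (diracDistr n) := by
  obtain ⟨R, -, hR⟩ := SmoothFun.exists_support_bound T
  set r := R ^ 2 + 1 with hr
  have hRr : R ^ 2 < r := by linarith
  set S := parametrixDistr (fun i => -diracAdjCoeffTranspose n i) T hn with hS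
  refine ⟨S.comp (cutoffCLM ((contDiff_slabCutoff 0 r).mul (contDiff_slabCutoff 1 r))
    (hasCompactSupport_slabCutoff_mul n r)), ?_⟩
  ext φ
  rw [diracDistr_apply, ContinuousLinearMap.comp_apply]
  set U : Set (Dom n) := {x | ‖x‖ ^ 2 < 2 * r + 2} with hU
  have hUo : IsOpen U := isOpen_lt (by fun_prop) continuous_const
  -- S acts only on Schwartz functions, so φ is truncated outside U. The bound 2r + 2 = (r + 1) + (r
  -- + 1) makes U contain every point where the product of the slab cutoffs is nonzero; U also
  -- contains the ball that carries T.
  set Φ := cutoffCLM (contDiff_ballCutoff (2 * r + 2)) (hasCompactSupport_ballCutoff (2 * r + 2)) φ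
    with hΦ
  have hΦU : ∀ x ∈ U, Φ x = φ x := fun x hx => by
    rw [hΦ, cutoffCLM_apply, ballCutoff_eq_one hx, one_smul]
  set θ := schwartzOp (fun i => -diracCoeffTranspose n i) Φ with hθ
  have hΦc : HasCompactSupport Φ :=
    (hasCompactSupport_ballCutoff (2 * r + 2)).smul_right (f' := φ)
  have hθc : HasCompactSupport θ := hasCompactSupport_schwartzOp _ hΦc
  have hθU : ∀ x ∈ U, θ x = diracTranspose n φ x := fun x hx => by
    have hev : (Φ : Dom n → V1 n) =ᶠ[𝓝 x] φ := by
      filter_upwards [hUo.mem_nhds hx] with y hy using hΦU y hy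
    rw [diracTranspose_eq_sum, hθ, schwartzOp_apply, hev.fderiv_eq]
  have hc1 : ContDiff ℝ ∞ fun x => (1 - slabCutoff n 1 r x) • θ x :=
    (contDiff_const.sub (contDiff_slabCutoff 1 r)).smul (θ.smooth ⊤)
  have hc2 : ContDiff ℝ ∞ fun x => (slabCutoff n 1 r x * (1 - slabCutoff n 0 r x)) • θ x :=
    ((contDiff_slabCutoff 1 r).mul (contDiff_const.sub (contDiff_slabCutoff 0 r))).smul
      (θ.smooth ⊤)
  set θ₁ : 𝓢(Dom n, V0 n) := HasCompactSupport.toSchwartzMap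
    (HasCompactSupport.smul_left (f := fun x => 1 - slabCutoff n 1 r x) hθc) hc1 with hθ₁
  set θ₂ : 𝓢(Dom n, V0 n) := HasCompactSupport.toSchwartzMap
    (HasCompactSupport.smul_left (f := fun x => slabCutoff n 1 r x * (1 - slabCutoff n 0 r x))
      hθc) hc2 with hθ₂
  -- With slab cutoffs χ₀, χ₁: 1 = χ₀χ₁ + (1 - χ₁) + χ₁(1 - χ₀). The last two terms vanish on the
  -- slabs in x_1 and x_0, so S kills θ₁ and θ₂.
  have hsplit : θ = cutoffCLM ((contDiff_slabCutoff 0 r).mul (contDiff_slabCutoff 1 r))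
      (hasCompactSupport_slabCutoff_mul n r) (diracTranspose n φ) + θ₁ + θ₂ := by
    ext1 x
    have h0 : (slabCutoff n 0 r x * slabCutoff n 1 r x) • diracTranspose n φ x =
        (slabCutoff n 0 r x * slabCutoff n 1 r x) • θ x := by
      by_cases hx : slabCutoff n 0 r x * slabCutoff n 1 r x = 0
      · rw [hx, zero_smul, zero_smul]
      · rw [hθU x (norm_sq_lt_of_slabCutoff_mul_ne_zero hx)]
    have h1 : θ₁ x = (1 - slabCutoff n 1 r x) • θ x := rfl
    have h2 : θ₂ x = (slabCutoff n 1 r x * (1 - slabCutoff n 0 r x)) • θ x := rfl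
    rw [add_apply, add_apply, cutoffCLM_apply, h0, h1, h2, ← add_smul, ← add_smul]
    ring_nf
    rw [one_smul]
  have hS1 : S θ₁ = 0 := parametrixDistr_eq_zero hn hT hR hRr (A := 0) (B := 1) (by simp) θ₁
    fun x hx => by
      change (1 - slabCutoff n 1 r x) • θ x = 0
      rw [slabCutoff_eq_one hx, sub_self, zero_smul]
  have hS2 : S θ₂ = 0 := parametrixDistr_eq_zero hn hT hR hRr (A := 1) (B := 0) (by simp) θ₂
    fun x hx => by
      change (slabCutoff n 1 r x * (1 - slabCutoff n 0 r x)) • θ x = 0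
      rw [slabCutoff_eq_one hx, sub_self, mul_zero, zero_smul]
  have hSθ : S θ = T (schwartzToSmooth Φ) :=
    parametrixDistr_schwartzOp _ T hn neg_diracCoeffTranspose_clifford (fun ψ hψ =>
      hT ψ (SmoothFun.ext fun x => (diracTranspose_eq_sum ψ x).trans (hψ x))) Φ
  have hTΦ : T (schwartzToSmooth Φ) = T φ := by
    rw [← sub_eq_zero, ← map_sub]
    refine hR _ U hUo (fun x hx => ?_) fun x hx => sub_eq_zero.2 (hΦU x hx)
    rw [mem_closedBall_zero_iff] at hx
    have h1 : ‖x‖ ^ 2 ≤ R ^ 2 := by gcongr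
    have h2 : 0 ≤ R ^ 2 := sq_nonneg R
    change ‖x‖ ^ 2 < 2 * r + 2
    linarith
  rw [← hTΦ, ← hSθ, hsplit, map_add, map_add, hS1, hS2, add_zero, add_zero]

end DistrRange

/-- The range is the annihilator of the kernel of 𝒟₀ᵗ, an intersection of kernels of evaluations,
which are continuous for the strong topology. -/
theorem isClosed_range_diracDistr (n : ℕ) : IsClosed (Set.range (diracDistr n)) := by
  rcases Nat.eq_zero_or_pos n with rfl | hn
  · have h : ∀ T, diracDistr 0 T = 0 := fun T => by
      ext φ
      simp [diracDistr_apply, diracTranspose]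
    have h' : Set.range (diracDistr 0) = {0} := by
      rw [funext h]
      exact Set.range_const
    rw [h']
    exact isClosed_singleton
  · have h : Set.range (diracDistr n) = ⋂ (ψ : SmoothSpace n (V1 n))
        (_ : diracTranspose n ψ = 0), {T : CompactDistr n (V1 n) | T ψ = 0} := by
      ext T
      simp only [Set.mem_iInter]
      constructor
      · rintro ⟨S, rfl⟩ ψ hψ
        change diracDistr n S ψ = 0
        rw [diracDistr_apply, hψ, map_zero]
      · exact mem_range_diracDistr hn
    rw [h]
    exact isClosed_iInter fun ψ => isClosed_iInter fun _ =>
      isClosed_eq (continuous_eval_const ψ) continuous_const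

end DiracComplex

end

theorem theorem4p2 (n : ℕ) :
    IsClosed (Set.range (DiracComplex.diracDistr n)) ∧
      IsClosed (Set.range (DiracComplex.diracTest n)) :=
  ⟨DiracComplex.isClosed_range_diracDistr n, DiracComplex.isClosed_range_diracTest n⟩
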